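/- Let $m,n\ge 1$ be integers and $N=1+m+n$. For $k\in\{1,\dots,N\}$ let $$\varphi_k(y)=\sum_{j\ge 1}(2\pi i y)^{2j}\,\frac{B_{2j}\,B_{2j+1}(k/N)}{2j\,(2j+1)!},$$ where $B_j(x)$ are the Bernoulli polynomials and $B_j=B_j(0)$, and let $$\varphi_{m,n}(\hbar)=-\varphi_{N-1}\big(\tfrac{N\hbar}{2\pi}\big)-\varphi_{N-m}\big(\tfrac{N\hbar}{2\pi}\big)+\varphi_{n}\big(\tfrac{N\hbar}{2\pi}\big)$$ be the weak-coupling perturbative series of local $\mathbb P^{m,n}$. Conventions. The Borel transform of a formal series $\phi(y)=\sum_{j\ge -p} c_j y^j$ is $\mathcal B[\phi](\zeta)=\sum_{r\ge 0}\frac{c_{r+1}}{r!}\zeta^r$, and $\phi$ is Gevrey-1 if $|c_{r+1}|\le C A^{-r} r!$ for some $A,C>0$ and all $r\ge 0$. If $\mathcal B[\phi]$ continues to a meromorphic function equal to $-\frac{S}{2\pi i(\zeta-\rho)}$ plus a holomorphic function near $\rho$, then $S$ is its Stokes constant at $\rho$. If $\mathcal B[\phi]$ continues analytically, with at most exponential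 growth, to an open sector around the ray $e^{i\theta}\mathbb R_{\ge 0}$, and $\mathrm{Re}(e^{-i\theta}y)>0$, the Borel--Laplace sum of $\phi$ at angle $\theta$ is $$s_\theta(\phi)(y)=\sum_{j\le 0}c_j y^j+\int_0^{e^{i\theta}\infty}e^{-\zeta/y}\,\mathcal B[\phi](\zeta)\,d\zeta ,$$ provided the integral converges absolutely. The median resummation at angle $\theta$ is $\mathcal S^{\rm med}_\theta\phi(y)=\tfrac12\big(s_{\theta+\epsilon}(\phi)(y)+s_{\theta-\epsilon}(\phi)(y)\big)$, where the lateral sums are required to exist and the value to be the same for all sufficiently small $\epsilon>0$ (depending on $y$). Asymptotic expansions as $y\to0$ in a half-plane are to all orders, in integer powers of $y$ with finitely many negative ones, uniformly on every proper subsector bisected by the axis of the half-plane. For $\ell\in\mathbb Z_{\ne0}$ let $$\xi_\ell=\frac{4\pi^2 i}{N}\,\ell,\qquad S_\ell^{m,n}=2i\Big(\sum_{d\mid \ell}\tfrac1d\sin\tfrac{2\pi d}{N}+\sum_{d\mid \ell}\tfrac1d\sin\tfrac{2\pi m d}{N}+\sum_{d\mid \ell}\tfrac1d\sin\tfrac{2\pi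 n d}{N}\Big),$$ where $d$ runs over the positive divisors of $\ell$, and let $$f_0^{m,n}(y)=\begin{cases}\ \ \sum_{\ell>0}S_\ell^{m,n}e^{2\pi i\ell y}, & \mathrm{Im}\,y>0,\\[2pt] -\sum_{\ell<0}S_\ell^{m,n}e^{2\pi i\ell y}, & \mathrm{Im}\,y<0.\end{cases}$$ Theorem. (0) The Borel transform of $\varphi_{m,n}$ extends to a meromorphic function on $\mathbb C$, holomorphic away from the points $\xi_\ell$, $\ell\neq0$, where it has at most simple poles, with Stokes constants $S_\ell^{m,n}$; thus $f_0^{m,n}$ is the generating function of the weak-coupling Stokes constants. (1) $f_0^{m,n}$ has an asymptotic expansion $\tilde f_0^{m,n}(y)$ as $y\to0$ with $\mathrm{Im}\,y>0$. It is Gevrey-1, and its median resummation at angle $\pi/2$ exists and reconstructs the function: $$\mathcal S^{\rm med}_{\pi/2}\tilde f_0^{m,n}(y)=f_0^{m,n}(y)\qquad\text{for all } y \text{ with } \mathrm{Im}\,y>0.$$ (2) Likewise $f_0^{m,n}$ has an asymptotic expansion $\tilde f_{0,-}^{m,n}(y)$ as $y\to0$ with $\mathrm{Im}\,y<0$. It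 is Gevrey-1, and its median resummation at angle $-\pi/2$ exists and satisfies $$\mathcal S^{\rm med}_{-\pi/2}\tilde f_{0,-}^{m,n}(y)=f_0^{m,n}(y)\qquad\text{for all } y \text{ with } \mathrm{Im}\,y<0.$$ -/

import Mathlib

open Complex Filter Topology Asymptotics

noncomputable section

namespace LocalP

/-! ### Formal series, Borel transform, Borel-Laplace sums, median resummation -/

/-- The open sector of directions around the ray `ℝ_{>0} e^{iθ}` whose points `z` satisfy
`c |z| < Re (e^{-iθ} z)`. For `c = 0` it is the open half-plane bisected by the ray, and for
`0 < c < 1` it is the proper subsector of half-opening angle `arccos c`. It never contains `0`. -/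
def sector (θ c : ℝ) : Set ℂ :=
  {z : ℂ | c * ‖z‖ < (exp (-(θ : ℂ) * I) * z).re}

/-- The truncation `∑_{j ≤ K} c_j y^j` of a formal series `∑ c_j y^j` with finitely many
negative powers. -/
def truncation (φ : LaurentSeries ℂ) (K : ℤ) (y : ℂ) : ℂ :=
  ∑ j ∈ Finset.Icc φ.order K, φ.coeff j * y ^ j

/-- `φ` is the (Poincare) asymptotic expansion of `f` as `y → 0` in the half-plane bisected by the
direction `θ`: to every order, uniformly on every proper subsector of the half-plane. -/
def IsAsymptoticExpansion (f : ℂ → ℂ) (θ : ℝ) (φ : LaurentSeries ℂ) : Prop :=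
  ∀ c : ℝ, 0 < c → c < 1 → ∀ K : ℤ,
    (fun y : ℂ => f y - truncation φ K y) =O[𝓝[sector θ c] 0] (fun y : ℂ => ‖y‖ ^ (K + 1))

/-- The positive part `∑_{n ≥ 0} a_n y^{n+1}` of the series satisfies `|a_n| ≤ C A^{-n} n!`. -/
def IsGevreyOne (φ : LaurentSeries ℂ) : Prop :=
  ∃ A C : ℝ, 0 < A ∧ ∀ n : ℕ, ‖φ.coeff ((n : ℤ) + 1)‖ ≤ C * (A ^ n)⁻¹ * (n.factorial : ℝ)

/-- Near the origin, `b` is the Borel transform `∑_{n ≥ 0} (a_n / n!) ζ^n` of the positive part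
`∑_{n ≥ 0} a_n y^{n+1}` of the series. -/
def IsBorelTransform (φ : LaurentSeries ℂ) (b : ℂ → ℂ) : Prop :=
  ∀ᶠ ζ : ℂ in 𝓝 0,
    HasSum (fun n : ℕ => φ.coeff ((n : ℤ) + 1) / (n.factorial : ℂ) * ζ ^ n) (b ζ)

/-- `s` is the Borel-Laplace sum at angle `θ` of the series `φ` at the point `y`: the Borel
transform continues analytically to an open sector around the ray of direction `θ`, with at most
exponential growth there, the Laplace integral along the ray converges absolutely, and `s` is this
integral plus the finitely many terms of `φ` of exponent `≤ 0`, which are left unchanged. (The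
continuation along the ray is unique, and so is `s`.) -/
def HasBorelLaplaceSum (φ : LaurentSeries ℂ) (θ : ℝ) (y s : ℂ) : Prop :=
  y ∈ sector θ 0 ∧
  ∃ (b : ℂ → ℂ) (c : ℝ), 0 < c ∧ c < 1 ∧
    IsBorelTransform φ b ∧
    DifferentiableOn ℂ b (sector θ c) ∧
    (∃ C κ : ℝ, ∀ ζ ∈ sector θ c, ‖b ζ‖ ≤ C * Real.exp (κ * ‖ζ‖)) ∧
    MeasureTheory.IntegrableOn
      (fun t : ℝ => exp (-((t : ℂ) * exp ((θ : ℂ) * I)) / y) * b ((t : ℂ) * exp ((θ : ℂ) * I))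
        * exp ((θ : ℂ) * I)) (Set.Ioi 0) ∧
    s = truncation φ 0 y +
      ∫ t in Set.Ioi (0 : ℝ),
        exp (-((t : ℂ) * exp ((θ : ℂ) * I)) / y) * b ((t : ℂ) * exp ((θ : ℂ) * I))
          * exp ((θ : ℂ) * I)

/-- `s` is the median resummation at angle `θ` of the series `φ` at the point `y`: the average of
the lateral Borel-Laplace sums at the angles `θ + ε` and `θ - ε`, for all small `ε > 0`. -/
def HasMedianSum (φ : LaurentSeries ℂ) (θ : ℝ) (y s : ℂ) : Prop :=
  ∀ᶠ ε : ℝ in 𝓝[>] 0, ∃ s₁ s₂ : ℂ,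
    HasBorelLaplaceSum φ (θ + ε) y s₁ ∧ HasBorelLaplaceSum φ (θ - ε) y s₂ ∧ s = (s₁ + s₂) / 2

/-- The Borel transform of `φ` extends to a meromorphic function on `ℂ`, holomorphic away from the
points `ρ ℓ`, `ℓ ≠ 0`, with at most a simple pole at `ρ ℓ`, and Stokes constant `S ℓ` there:
it equals `- S_ℓ / (2πi (ζ - ρ_ℓ))` plus a holomorphic function near `ρ ℓ`. -/
def HasStokesConstants (φ : LaurentSeries ℂ) (ρ S : ℤ → ℂ) : Prop :=
  ∃ b : ℂ → ℂ, IsBorelTransform φ b ∧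
    (∀ ζ : ℂ, (∀ ℓ : ℤ, ℓ ≠ 0 → ζ ≠ ρ ℓ) → AnalyticAt ℂ b ζ) ∧
    ∀ ℓ : ℤ, ℓ ≠ 0 → ∃ h : ℂ → ℂ, AnalyticAt ℂ h (ρ ℓ) ∧
      ∀ᶠ ζ : ℂ in 𝓝[≠] (ρ ℓ), b ζ = -(S ℓ) / (2 * Real.pi * I * (ζ - ρ ℓ)) + h ζ

/-! ### The objects attached to local `ℙ^{m,n}` -/

/-- The formal power series
`φ_k(y) = ∑_{j ≥ 1} (2πi y)^{2j} B_{2j} B_{2j+1}(k/N) / (2j (2j+1)!)`. -/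
def phi (N k : ℕ) : PowerSeries ℂ :=
  PowerSeries.mk fun i : ℕ =>
    if i ≠ 0 ∧ Even i then
      (2 * Real.pi * I) ^ i * ((bernoulli i : ℚ) : ℂ)
        * (((Polynomial.bernoulli (i + 1)).eval ((k : ℚ) / (N : ℚ)) : ℚ) : ℂ)
        / ((i : ℂ) * ((i + 1).factorial : ℂ))
    else 0

/-- With `N = 1 + m + n`, the weak-coupling series
`φ_{m,n}(ħ) = - φ_{N-1}(Nħ/2π) - φ_{N-m}(Nħ/2π) + φ_n(Nħ/2π)` in the variable `ħ`. -/
def phiMN (m n : ℕ) : PowerSeries ℂ :=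
  PowerSeries.rescale (((1 + m + n : ℕ) : ℂ) / (2 * Real.pi))
    (-phi (1 + m + n) ((1 + m + n) - 1) - phi (1 + m + n) ((1 + m + n) - m) + phi (1 + m + n) n)

/-- The points `ξ_ℓ = 4π² i ℓ / N` of the Borel plane, with `N = 1 + m + n`. -/
def xi (m n : ℕ) (ℓ : ℤ) : ℂ :=
  4 * Real.pi ^ 2 * I * ℓ / ((1 + m + n : ℕ) : ℂ)

/-- `∑_{d ∣ ℓ} (1/d) sin (2πkd/N)`, over the positive divisors `d` of the non-zero integer `ℓ`. -/
def sineDivisorSum (N k : ℕ) (ℓ : ℤ) : ℝ :=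
  ∑ d ∈ ℓ.natAbs.divisors, 1 / (d : ℝ) * Real.sin (2 * Real.pi * k * d / N)

/-- The weak-coupling Stokes constants `S_ℓ^{m,n}`, `ℓ ≠ 0`; the indices `1, m, n` are counted
with repetition. -/
def stokesS (m n : ℕ) (ℓ : ℤ) : ℂ :=
  2 * I * ((sineDivisorSum (1 + m + n) 1 ℓ + sineDivisorSum (1 + m + n) m ℓ
    + sineDivisorSum (1 + m + n) n ℓ : ℝ) : ℂ)

/-- The generating function `f_0^{m,n}` of the weak-coupling Stokes constants on `ℂ ∖ ℝ`
(extended by `0` to the real line, where it is never used). -/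
def f0 (m n : ℕ) (y : ℂ) : ℂ :=
  if 0 < y.im then
    ∑' ℓ : ℕ, stokesS m n ((ℓ : ℤ) + 1) * exp (2 * Real.pi * I * ((ℓ : ℂ) + 1) * y)
  else if y.im < 0 then
    -∑' ℓ : ℕ, stokesS m n (-((ℓ : ℤ) + 1)) * exp (2 * Real.pi * I * (-((ℓ : ℂ) + 1)) * y)
  else 0

end LocalP

end

/-! Write `t_d = 2i (sin(2πd/N) + sin(2πmd/N) + sin(2πnd/N))`. Since `S_ℓ = ∑_{d ∣ ℓ} t_d / d`
depends only on `|ℓ|`, on the upper half-plane `f0` is the Lambert series `∑ (t_d / d) q^d / (1 -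
q^d)` with `q = e^{2πiy}`, and on the lower one it is minus that series at `-y`.

Each sine contributes `w^d - w^{-d}` to `t_d`, for a root of unity `w ≠ 1`. Hence `β(η) = ∑ t_d
e^{-dη}` continues to a function that is even, analytic at `0`, and singular only on the imaginary
axis. The Borel transform is `(1/πi) ∑_ℓ ℓ^{-2} β(ζ/ℓ)`. It is bounded on thin sectors off the
imaginary axis, so both lateral Laplace integrals exist.

On a ray in the right half-plane, integration term by term gives formally `∑ t_d / (ℓ (ℓ/y + d))`;
on a ray in the left half-plane, evenness gives minus the same series at `-y`. The sum of the two
lateral integrals is therefore a difference of double series. Summing it over `ℓ` first produces `π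
cot(πdy)`, hence `q^d / (1 - q^d)`, together with a constant and a multiple of `1/y`; these last two
are cancelled by the terms of exponent `0` and `-1` of the series
(`IsEvenDirichlet.median_identity`). The series in `d` do not converge absolutely, so Abel summation
against the bounded partial sums of `t` is used throughout. Watson's lemma gives the asymptotic
expansion, convergence of the Borel transform gives the Gevrey bound, and uniqueness of expansions
transfers both, and the median sum, to every expansion of `f0`.

For the Stokes constants, the candidate is `(1/πi) ∑_k S_k ζ / (ξ_k² - ζ²)`. Its Taylor coefficients
involve `∑ S_k k^{-s} = ζ(s) ∑ t_d d^{-s-1}` at even `s`. Euler's formula and the Fourier series of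
the Bernoulli polynomials identify them with the coefficients of the weak-coupling series
(`coeff_phiMN_even`). -/

namespace LocalP

/-! ### Truncations and uniqueness of asymptotic expansions -/

/-- Coefficients below the order vanish. A common lower bound lets truncations of two series of
different orders be compared term by term. -/
theorem truncation_eq_sum_Icc (φ : LaurentSeries ℂ) {o : ℤ} (ho : o ≤ φ.order) (K : ℤ) (y : ℂ) :
    truncation φ K y = ∑ j ∈ Finset.Icc o K, φ.coeff j * y ^ j := by
  refine Finset.sum_subset (Finset.Icc_subset_Icc_left ho) fun j hj hj' => ?_
  rw [HahnSeries.coeff_eq_zero_of_lt_order, zero_mul]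
  simp only [Finset.mem_Icc] at hj hj'
  omega

theorem truncation_add_one (φ : LaurentSeries ℂ) (K : ℤ) (y : ℂ) :
    truncation φ (K + 1) y = truncation φ K y + φ.coeff (K + 1) * y ^ (K + 1) := by
  have h1 : min φ.order (K + 1) ≤ φ.order := min_le_left _ _
  rw [truncation_eq_sum_Icc φ h1, truncation_eq_sum_Icc φ h1]
  have h2 : min φ.order (K + 1) ≤ K + 1 := min_le_right _ _
  generalize min φ.order (K + 1) = o at h2
  have : Finset.Icc o (K + 1) = insert (K + 1) (Finset.Icc o K) := by
    ext j; simp only [Finset.mem_Icc, Finset.mem_insert]; omega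
  rw [this, Finset.sum_insert (by simp), add_comm]

theorem truncation_natCast (φ : LaurentSeries ℂ) (R : ℕ) (y : ℂ) :
    truncation φ R y = truncation φ 0 y +
      ∑ r ∈ Finset.range R, φ.coeff ((r : ℤ) + 1) * y ^ (r + 1) := by
  induction R with
  | zero => simp
  | succ R ih =>
    rw [Finset.sum_range_succ, ← add_assoc, ← ih]
    push_cast
    rw [truncation_add_one]
    norm_cast

theorem sector_exp_mem {θ c : ℝ} (hc : c < 1) {t : ℝ} (ht : 0 < t) :
    (t : ℂ) * exp ((θ : ℂ) * I) ∈ sector θ c := by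
  have h : exp (-(θ : ℂ) * I) * ((t : ℂ) * exp ((θ : ℂ) * I)) = t := by
    rw [mul_left_comm, ← exp_add]; simp
  simp only [sector, Set.mem_ofPred_eq, h, ofReal_re, norm_mul, norm_exp_ofReal_mul_I, mul_one,
    norm_real, Real.norm_eq_abs, abs_of_pos ht]
  nlinarith

theorem tendsto_ray (θ : ℝ) {c : ℝ} (hc : c < 1) :
    Tendsto (fun t : ℝ => (t : ℂ) * exp ((θ : ℂ) * I)) (𝓝[>] 0) (𝓝[sector θ c] 0) := by
  refine tendsto_nhdsWithin_iff.2 ⟨?_, ?_⟩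
  · have : Continuous fun t : ℝ => (t : ℂ) * exp ((θ : ℂ) * I) := by fun_prop
    have h := this.tendsto 0
    simp only [ofReal_zero, zero_mul] at h
    exact h.mono_left nhdsWithin_le_nhds
  · filter_upwards [self_mem_nhdsWithin] with t ht
    exact sector_exp_mem hc ht

/-- At the first exponent `K` where the coefficients could differ, their difference times `y ^ K` is
`O(‖y‖ ^ (K + 1))`; letting `y → 0` along the bisecting ray makes it vanish. Any subsector contains
that ray, so the opening `1/2` is arbitrary. -/
theorem IsAsymptoticExpansion.unique {f : ℂ → ℂ} {θ : ℝ} {φ ψ : LaurentSeries ℂ}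
    (hφ : IsAsymptoticExpansion f θ φ) (hψ : IsAsymptoticExpansion f θ ψ) : φ = ψ := by
  set o := min φ.order ψ.order with ho
  have key : ∀ k : ℕ, φ.coeff (o + k) = ψ.coeff (o + k) := by
    intro k
    induction k using Nat.strong_induction_on with
    | _ k ih =>
    set K : ℤ := o + k with hK
    have h := (hψ (1/2) (by norm_num) (by norm_num) K).sub
      (hφ (1/2) (by norm_num) (by norm_num) K)
    have h2 : ∀ y : ℂ, (f y - truncation ψ K y) - (f y - truncation φ K y)
        = (φ.coeff K - ψ.coeff K) * y ^ K := by
      intro y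
      rw [truncation_eq_sum_Icc φ (min_le_left _ _ : o ≤ _),
        truncation_eq_sum_Icc ψ (min_le_right _ _ : o ≤ _), sub_sub_sub_cancel_left,
        ← Finset.sum_sub_distrib]
      rw [Finset.sum_eq_single K]
      · ring
      · intro j hj hjK
        rw [Finset.mem_Icc] at hj
        have := ih (j - o).toNat (by omega)
        rw [show o + ((j - o).toNat : ℤ) = j by omega] at this
        rw [this]; ring
      · intro h; exact absurd (Finset.mem_Icc.2 ⟨by omega, le_rfl⟩) h
    simp only [h2] at h
    have h3 := h.comp_tendsto (tendsto_ray θ (by norm_num : (1/2 : ℝ) < 1))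
    obtain ⟨C, hC⟩ := h3.bound
    have h4 : ∀ᶠ t : ℝ in 𝓝[>] 0, ‖φ.coeff K - ψ.coeff K‖ ≤ C * t := by
      filter_upwards [hC, self_mem_nhdsWithin] with t ht ht0
      have ht0 : 0 < t := ht0
      simp only [Function.comp, norm_mul, norm_zpow, norm_exp_ofReal_mul_I, mul_one, norm_real,
        Real.norm_eq_abs, abs_of_pos ht0] at ht
      rw [zpow_add_one₀ ht0.ne'] at ht
      have : 0 < t ^ K := zpow_pos ht0 K
      refine le_of_mul_le_mul_right (a := t ^ K) ?_ this
      linarith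
    have h5 : Tendsto (fun t : ℝ => C * t) (𝓝[>] 0) (𝓝 0) := by
      have : Continuous fun t : ℝ => C * t := by fun_prop
      have h := this.tendsto 0
      rw [mul_zero] at h
      exact h.mono_left nhdsWithin_le_nhds
    exact sub_eq_zero.1 (norm_le_zero_iff.1 (ge_of_tendsto h5 h4))
  ext j
  rcases lt_or_ge j o with hj | hj
  · rw [HahnSeries.coeff_eq_zero_of_lt_order (hj.trans_le (min_le_left _ _)),
      HahnSeries.coeff_eq_zero_of_lt_order (hj.trans_le (min_le_right _ _))]
  · have := key (j - o).toNat
    rwa [show o + ((j - o).toNat : ℤ) = j by omega] at this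

/-- It is enough to bound the remainders of an asymptotic expansion for large orders. -/
theorem isAsymptoticExpansion_of_nat {f : ℂ → ℂ} {θ : ℝ} {φ : LaurentSeries ℂ}
    (h : ∀ c : ℝ, 0 < c → c < 1 → ∀ R : ℕ,
      (fun y : ℂ => f y - truncation φ R y) =O[𝓝[sector θ c] 0]
        (fun y : ℂ => ‖y‖ ^ ((R : ℤ) + 1))) :
    IsAsymptoticExpansion f θ φ := by
  intro c hc0 hc1 K
  -- Induction on the gap `k` between `K` and `max K 0`: going from order `K + 1` down to `K`
  -- restores one term, itself of size `‖y‖ ^ (K + 1)`.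
  have step : ∀ (k : ℕ) (K : ℤ), K + k = K.toNat →
      (fun y : ℂ => f y - truncation φ K y) =O[𝓝[sector θ c] 0] (fun y : ℂ => ‖y‖ ^ (K + 1)) := by
    intro k
    induction k with
    | zero =>
      intro K hK
      have := h c hc0 hc1 K.toNat
      rwa [show ((K.toNat : ℕ) : ℤ) = K by push_cast at hK; omega] at this
    | succ k ih =>
      intro K hK
      have hK' : K < 0 := by push_cast at hK; omega
      have h1 := ih (K + 1) (by push_cast at hK; omega)
      have h2 : (fun y : ℂ => φ.coeff (K + 1) * y ^ (K + 1)) =O[𝓝[sector θ c] 0]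
          (fun y : ℂ => ‖y‖ ^ (K + 1)) := by
        refine IsBigO.of_bound ‖φ.coeff (K + 1)‖ (Eventually.of_forall fun y => ?_)
        simp
      have h3 : (fun y : ℂ => ‖y‖ ^ (K + 1 + 1)) =O[𝓝[sector θ c] 0]
          (fun y : ℂ => ‖y‖ ^ (K + 1)) := by
        refine IsBigO.of_bound 1 ?_
        have : ∀ᶠ y : ℂ in 𝓝[sector θ c] 0, ‖y‖ < 1 := by
          refine nhdsWithin_le_nhds ?_
          have := Metric.ball_mem_nhds (0 : ℂ) one_pos
          filter_upwards [this] with y hy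
          simpa using hy
        filter_upwards [this, self_mem_nhdsWithin] with y hy hy'
        have hy0 : 0 < ‖y‖ := by
          refine norm_pos_iff.2 ?_
          rintro rfl
          simp [sector] at hy'
        rw [zpow_add_one₀ hy0.ne', norm_mul, one_mul, norm_norm]
        exact mul_le_of_le_one_right (norm_nonneg _) hy.le
      refine ((h1.trans h3).add h2).congr_left fun y => ?_
      rw [truncation_add_one]; ring
  exact step (K.toNat - K).toNat K (by omega)

/-! ### Watson's lemma -/

theorem re_exp_div (θ : ℝ) (y : ℂ) :
    (exp ((θ : ℂ) * I) / y).re = (exp (-(θ : ℂ) * I) * y).re / ‖y‖ ^ 2 := by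
  have h : exp ((θ : ℂ) * I) / y = (exp (-(θ : ℂ) * I) * y)⁻¹ := by
    rw [mul_inv, ← exp_neg, neg_mul, neg_neg, div_eq_mul_inv]
  rw [h, inv_re, normSq_eq_norm_sq, norm_mul, neg_mul, ← neg_mul, ← ofReal_neg,
    norm_exp_ofReal_mul_I, one_mul]

theorem integrableOn_pow_mul_exp_neg {p : ℝ} (hp : 0 < p) (r : ℕ) :
    MeasureTheory.IntegrableOn (fun t : ℝ => t ^ r * Real.exp (-(p * t))) (Set.Ioi 0) := by
  have h := integrableOn_rpow_mul_exp_neg_mul_rpow (p := 1) (s := r) (b := p)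
    (by have : (0 : ℝ) ≤ r := r.cast_nonneg
        linarith) one_pos hp
  simpa using h

theorem norm_pow_mul_exp_neg (a : ℂ) (r : ℕ) {t : ℝ} (ht : 0 < t) :
    ‖(t : ℂ) ^ r * exp (-(a * t))‖ = t ^ r * Real.exp (-(a.re * t)) := by
  rw [norm_mul, norm_pow, norm_real, Real.norm_eq_abs, abs_of_pos ht, norm_exp]
  simp

theorem integrableOn_pow_mul_cexp_neg {a : ℂ} (ha : 0 < a.re) (r : ℕ) :
    MeasureTheory.IntegrableOn (fun t : ℝ => (t : ℂ) ^ r * exp (-(a * t))) (Set.Ioi 0) := by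
  refine MeasureTheory.Integrable.mono' (integrableOn_pow_mul_exp_neg ha r)
    (by fun_prop) ?_
  filter_upwards [MeasureTheory.ae_restrict_mem measurableSet_Ioi] with t ht
  exact (norm_pow_mul_exp_neg a r ht).le

theorem integral_pow_mul_cexp_neg {a : ℂ} (ha : 0 < a.re) (r : ℕ) :
    ∫ t in Set.Ioi (0 : ℝ), (t : ℂ) ^ r * exp (-(a * t)) = r.factorial / a ^ (r + 1) := by
  have ha0 : a ≠ 0 := by rintro rfl; simp at ha
  induction r with
  | zero =>
    have h := integral_exp_mul_complex_Ioi (a := -a) (by simpa using ha) 0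
    simpa [neg_mul] using h
  | succ r ih =>
    -- Integrating this derivative over the half-line is integration by parts: `a` times the moment
    -- of order `r + 1` is `r + 1` times the moment of order `r`.
    have hd : ∀ t ∈ Set.Ioi (0 : ℝ), HasDerivAt (fun t : ℝ => (t : ℂ) ^ (r + 1) * exp (-(a * t)))
        ((r + 1 : ℂ) * ((t : ℂ) ^ r * exp (-(a * t)))
          - a * ((t : ℂ) ^ (r + 1) * exp (-(a * t)))) t := by
      intro t _
      have h1 : HasDerivAt (fun z : ℂ => z ^ (r + 1) * exp (-(a * z)))
          ((r + 1 : ℂ) * ((t : ℂ) ^ r * exp (-(a * t)))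
            - a * ((t : ℂ) ^ (r + 1) * exp (-(a * t)))) t := by
        have h2 := (hasDerivAt_pow (r + 1) (t : ℂ)).mul
          (((hasDerivAt_id (t : ℂ)).const_mul a).neg.cexp)
        refine HasDerivAt.congr_deriv (f := fun z : ℂ => z ^ (r + 1) * exp (-(a * z))) h2 ?_
        simp
        ring
      exact h1.comp_ofReal
    have hi1 := (integrableOn_pow_mul_cexp_neg ha r).const_mul (r + 1 : ℂ)
    have hi2 := (integrableOn_pow_mul_cexp_neg ha (r + 1)).const_mul a
    have hlim : Tendsto (fun t : ℝ => (t : ℂ) ^ (r + 1) * exp (-(a * t))) atTop (𝓝 0) := by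
      rw [tendsto_zero_iff_norm_tendsto_zero]
      have h := tendsto_rpow_mul_exp_neg_mul_atTop_nhds_zero (r + 1 : ℕ) a.re ha
      refine h.congr' ?_
      filter_upwards [eventually_gt_atTop 0] with t ht
      rw [norm_pow_mul_exp_neg a _ ht, Real.rpow_natCast, neg_mul]
    have h := MeasureTheory.integral_Ioi_of_hasDerivAt_of_tendsto
      (Continuous.continuousWithinAt (by fun_prop)) hd (hi1.sub hi2) hlim
    rw [MeasureTheory.integral_sub hi1 hi2, MeasureTheory.integral_const_mul,
      MeasureTheory.integral_const_mul, ih] at h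
    have h' : (r + 1 : ℂ) * (r.factorial / a ^ (r + 1))
        = a * ∫ t in Set.Ioi (0 : ℝ), (t : ℂ) ^ (r + 1) * exp (-(a * t)) := by
      rw [← sub_eq_zero, h]; simp
    rw [Nat.factorial_succ, eq_div_iff (pow_ne_zero _ ha0), pow_succ a (r + 1)]
    push_cast
    rw [← mul_assoc, mul_right_comm, mul_comm _ a, ← h']
    field_simp

theorem integral_pow_mul_exp_neg {p : ℝ} (hp : 0 < p) (r : ℕ) :
    ∫ t in Set.Ioi (0 : ℝ), t ^ r * Real.exp (-(p * t)) = r.factorial / p ^ (r + 1) := by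
  have h2 := integral_pow_mul_cexp_neg (a := (p : ℂ)) (by simpa using hp) r
  have h3 : ∀ t : ℝ, (t : ℂ) ^ r * exp (-((p : ℂ) * t))
      = ((t ^ r * Real.exp (-(p * t)) : ℝ) : ℂ) := fun t => by push_cast; rfl
  simp only [h3] at h2
  rw [integral_complex_ofReal] at h2
  exact_mod_cast h2

theorem IsBorelTransform.exists_bound {φ : LaurentSeries ℂ} {b : ℂ → ℂ}
    (h : IsBorelTransform φ b) :
    ∃ ρ C : ℝ, 0 < ρ ∧ (∀ r : ℕ, ‖φ.coeff ((r : ℤ) + 1) / (r.factorial : ℂ)‖ * ρ ^ r ≤ C) ∧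
      ∀ ζ : ℂ, ‖ζ‖ ≤ ρ →
        HasSum (fun r : ℕ => φ.coeff ((r : ℤ) + 1) / (r.factorial : ℂ) * ζ ^ r) (b ζ) := by
  obtain ⟨ρ, hρ, hs⟩ := Metric.nhds_basis_closedBall.eventually_iff.1 h
  have h1 := (hs (x := (ρ : ℂ)) (by simp [abs_of_pos hρ])).summable.norm
  refine ⟨ρ, ∑' r : ℕ, ‖φ.coeff ((r : ℤ) + 1) / (r.factorial : ℂ) * (ρ : ℂ) ^ r‖, hρ,
    fun r => ?_, fun ζ hζ => hs (by simpa using hζ)⟩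
  have := h1.le_tsum r fun j _ => norm_nonneg _
  rwa [norm_mul, norm_pow, norm_real, Real.norm_eq_abs, abs_of_pos hρ] at this

/-- Convergence of `∑ a_r ζ^r / r!` at `ζ = ρ` bounds `|a_r| ρ^r / r!`, so the radius `ρ` serves as
the Gevrey constant `A`. -/
theorem IsBorelTransform.isGevreyOne {φ : LaurentSeries ℂ} {b : ℂ → ℂ}
    (h : IsBorelTransform φ b) : IsGevreyOne φ := by
  obtain ⟨ρ, C, hρ, hC, -⟩ := h.exists_bound
  refine ⟨ρ, C, hρ, fun r => ?_⟩
  have h0 : (0 : ℝ) < r.factorial := by exact_mod_cast r.factorial_pos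
  have := hC r
  rw [norm_div, norm_natCast, div_mul_eq_mul_div, div_le_iff₀ h0] at this
  rw [← div_eq_mul_inv, div_mul_eq_mul_div, le_div_iff₀ (pow_pos hρ r)]
  exact this

/-- The Taylor remainders of a Borel transform that is bounded on a set are bounded there by a
power of `ζ`. -/
theorem IsBorelTransform.exists_remainder_bound {φ : LaurentSeries ℂ} {b : ℂ → ℂ}
    (h : IsBorelTransform φ b) {s : Set ℂ} {B : ℝ} (hB : ∀ ζ ∈ s, ‖b ζ‖ ≤ B) (R : ℕ) :
    ∃ C : ℝ, 0 ≤ C ∧ ∀ ζ ∈ s,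
      ‖b ζ - ∑ r ∈ Finset.range R, φ.coeff ((r : ℤ) + 1) / (r.factorial : ℂ) * ζ ^ r‖
        ≤ C * ‖ζ‖ ^ R := by
  obtain ⟨ρ, C, hρ, hC, hs⟩ := h.exists_bound
  have hC0 : 0 ≤ C := le_trans (by positivity) (hC 0)
  set p : ℕ → ℂ := fun r => φ.coeff ((r : ℤ) + 1) / (r.factorial : ℂ) with hp
  set x : ℝ := ρ / 2 with hx
  have hx0 : 0 < x := by positivity
  set D : ℝ := |B| / x ^ R + ∑ r ∈ Finset.range R, ‖p r‖ * x ^ r / x ^ R with hD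
  have hD0 : 0 ≤ D := by positivity
  refine ⟨max (2 * C / ρ ^ R) D, le_max_of_le_right hD0, fun ζ hζ => ?_⟩
  -- Within half the radius of convergence the Taylor tail is geometric of ratio `1/2`. Beyond it,
  -- `‖ζ‖ ^ R ≥ x ^ R` is bounded below, and `D` absorbs both `B` and the Taylor polynomial.
  rcases le_or_gt ‖ζ‖ x with hz | hz
  · have h1 := (hasSum_nat_add_iff' R).2 (hs ζ (by linarith))
    have h2 : ∀ r : ℕ, ‖p (r + R) * ζ ^ (r + R)‖ ≤ C / ρ ^ R * ‖ζ‖ ^ R * (1 / 2) ^ r := by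
      intro r
      have h3 : ‖p (r + R)‖ ≤ C / ρ ^ (r + R) := (le_div_iff₀ (pow_pos hρ _)).2 (hC (r + R))
      have h4 : ‖ζ‖ ^ r ≤ x ^ r := pow_le_pow_left₀ (norm_nonneg _) hz r
      calc ‖p (r + R) * ζ ^ (r + R)‖ = ‖p (r + R)‖ * (‖ζ‖ ^ r * ‖ζ‖ ^ R) := by
            rw [norm_mul, norm_pow, pow_add]
        _ ≤ C / ρ ^ (r + R) * (x ^ r * ‖ζ‖ ^ R) := by gcongr
        _ = C / ρ ^ R * ‖ζ‖ ^ R * (1 / 2) ^ r := by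
            rw [hx, pow_add, div_pow, div_pow, one_pow]; field_simp
    have h5 := tsum_of_norm_bounded (hasSum_geometric_two.mul_left (C / ρ ^ R * ‖ζ‖ ^ R)) h2
    rw [h1.tsum_eq] at h5
    refine h5.trans ?_
    calc C / ρ ^ R * ‖ζ‖ ^ R * 2 = 2 * C / ρ ^ R * ‖ζ‖ ^ R := by ring
      _ ≤ _ := by gcongr; exact le_max_left _ _
  · have hz0 : 0 < ‖ζ‖ := hx0.trans hz
    have h1 : ‖b ζ‖ ≤ |B| / x ^ R * ‖ζ‖ ^ R := by
      rw [div_mul_eq_mul_div, le_div_iff₀ (pow_pos hx0 R)]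
      have := (hB ζ hζ).trans (le_abs_self B)
      gcongr
    have h2 : ∀ r ∈ Finset.range R, ‖p r * ζ ^ r‖ ≤ ‖p r‖ * x ^ r / x ^ R * ‖ζ‖ ^ R := by
      intro r hr
      obtain ⟨k, rfl⟩ := Nat.exists_eq_add_of_le (Finset.mem_range.1 hr).le
      have : x ^ k ≤ ‖ζ‖ ^ k := pow_le_pow_left₀ hx0.le hz.le k
      rw [norm_mul, norm_pow, pow_add, pow_add, div_mul_eq_mul_div,
        le_div_iff₀ (by positivity)]
      calc ‖p r‖ * ‖ζ‖ ^ r * (x ^ r * x ^ k) ≤ ‖p r‖ * ‖ζ‖ ^ r * (x ^ r * ‖ζ‖ ^ k) := by gcongr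
        _ = _ := by ring
    calc _ ≤ ‖b ζ‖ + ∑ r ∈ Finset.range R, ‖p r * ζ ^ r‖ :=
          (norm_sub_le _ _).trans (add_le_add_right (norm_sum_le _ _) _)
      _ ≤ |B| / x ^ R * ‖ζ‖ ^ R + ∑ r ∈ Finset.range R, ‖p r‖ * x ^ r / x ^ R * ‖ζ‖ ^ R :=
          add_le_add h1 (Finset.sum_le_sum h2)
      _ = D * ‖ζ‖ ^ R := by rw [← Finset.sum_mul, ← add_mul]
      _ ≤ _ := by gcongr; exact le_max_right _ _

theorem integrableOn_laplace {b : ℂ → ℂ} {θ : ℝ} {y : ℂ}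
    (hy : 0 < (exp ((θ : ℂ) * I) / y).re) {B : ℝ}
    (hB : ∀ t : ℝ, 0 < t → ‖b ((t : ℂ) * exp ((θ : ℂ) * I))‖ ≤ B)
    (hcont : ContinuousOn (fun t : ℝ => b ((t : ℂ) * exp ((θ : ℂ) * I))) (Set.Ioi 0)) :
    MeasureTheory.IntegrableOn
      (fun t : ℝ => exp (-((t : ℂ) * exp ((θ : ℂ) * I)) / y) * b ((t : ℂ) * exp ((θ : ℂ) * I))
        * exp ((θ : ℂ) * I)) (Set.Ioi 0) := by
  have h0 := (integrableOn_pow_mul_exp_neg hy 0).const_mul B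
  refine MeasureTheory.Integrable.mono' h0 ?_ ?_
  · refine ContinuousOn.aestronglyMeasurable ?_ measurableSet_Ioi
    exact ((Continuous.continuousOn (by fun_prop)).mul hcont).mul continuousOn_const
  · filter_upwards [MeasureTheory.ae_restrict_mem measurableSet_Ioi] with t ht
    have h1 : -((t : ℂ) * exp ((θ : ℂ) * I)) / y = -(exp ((θ : ℂ) * I) / y * t) := by ring
    rw [norm_mul, norm_mul, norm_exp_ofReal_mul_I, mul_one, h1, norm_exp]
    have h2 : (-(exp ((θ : ℂ) * I) / y * (t : ℂ))).re = -((exp ((θ : ℂ) * I) / y).re * t) := by simp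
    rw [h2, pow_zero, one_mul, mul_comm]
    exact mul_le_mul_of_nonneg_right (hB t ht) (Real.exp_pos _).le

/-- Watson's lemma: the Laplace integral of the Borel transform of a series has this series
(without its terms of exponent `≤ 0`) as its asymptotic expansion. -/
theorem IsBorelTransform.watson {φ : LaurentSeries ℂ} {b : ℂ → ℂ} (h : IsBorelTransform φ b)
    {θ : ℝ} {B : ℝ} (hB : ∀ t : ℝ, 0 < t → ‖b ((t : ℂ) * exp ((θ : ℂ) * I))‖ ≤ B)
    (hcont : ContinuousOn (fun t : ℝ => b ((t : ℂ) * exp ((θ : ℂ) * I))) (Set.Ioi 0))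
    (R : ℕ) {κ : ℝ} (hκ : 0 < κ) :
    ∃ C : ℝ, ∀ y : ℂ, y ≠ 0 → κ * ‖y‖ ≤ (exp (-(θ : ℂ) * I) * y).re →
      ‖(∫ t in Set.Ioi (0 : ℝ),
        exp (-((t : ℂ) * exp ((θ : ℂ) * I)) / y) * b ((t : ℂ) * exp ((θ : ℂ) * I))
          * exp ((θ : ℂ) * I))
        - ∑ r ∈ Finset.range R, φ.coeff ((r : ℤ) + 1) * y ^ (r + 1)‖ ≤ C * ‖y‖ ^ (R + 1) := by
  set e : ℂ := exp ((θ : ℂ) * I) with he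
  have hen : ‖e‖ = 1 := norm_exp_ofReal_mul_I θ
  have he0 : e ≠ 0 := exp_ne_zero _
  obtain ⟨C, hC0, hC⟩ := h.exists_remainder_bound (s := {ζ | ∃ t : ℝ, 0 < t ∧ ζ = t * e})
    (by rintro _ ⟨t, ht, rfl⟩; exact hB t ht) R
  refine ⟨C * R.factorial / κ ^ (R + 1), fun y hy0 hy => ?_⟩
  have hyn : 0 < ‖y‖ := norm_pos_iff.2 hy0
  set a : ℂ := e / y with ha
  have hay : ∀ t : ℝ, -((t : ℂ) * e) / y = -(a * t) := fun t => by rw [ha]; ring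
  -- This is where the subsector enters: it turns the moment `R! / a.re ^ (R + 1)` into a multiple
  -- of `‖y‖ ^ (R + 1)`, uniformly in `y`.
  have hare : κ / ‖y‖ ≤ a.re := by
    rw [ha, he, re_exp_div, div_le_div_iff₀ hyn (by positivity)]
    nlinarith
  have ha0 : 0 < a.re := (div_pos hκ hyn).trans_le hare
  have hi := integrableOn_laplace ha0 hB hcont
  set p : ℕ → ℂ := fun r => φ.coeff ((r : ℤ) + 1) / (r.factorial : ℂ) with hp
  have hterm : ∀ r ∈ Finset.range R, MeasureTheory.IntegrableOn
      (fun t : ℝ => p r * e ^ (r + 1) * ((t : ℂ) ^ r * exp (-(a * t)))) (Set.Ioi 0) :=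
    fun r _ => (integrableOn_pow_mul_cexp_neg ha0 r).const_mul _
  have hsum : ∫ t in Set.Ioi (0 : ℝ), ∑ r ∈ Finset.range R,
      p r * e ^ (r + 1) * ((t : ℂ) ^ r * exp (-(a * t)))
      = ∑ r ∈ Finset.range R, φ.coeff ((r : ℤ) + 1) * y ^ (r + 1) := by
    rw [MeasureTheory.integral_finsetSum _ hterm]
    refine Finset.sum_congr rfl fun r _ => ?_
    have hr : (r.factorial : ℂ) ≠ 0 := by exact_mod_cast r.factorial_ne_zero
    rw [MeasureTheory.integral_const_mul, integral_pow_mul_cexp_neg ha0, ha, hp, div_pow]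
    field_simp
  rw [← hsum, ← MeasureTheory.integral_sub hi (MeasureTheory.integrable_finsetSum _ hterm)]
  have hb := (integrableOn_pow_mul_exp_neg ha0 R).const_mul C
  refine (MeasureTheory.norm_integral_le_of_norm_le hb ?_).trans ?_
  · filter_upwards [MeasureTheory.ae_restrict_mem measurableSet_Ioi] with t ht
    have ht : 0 < t := ht
    have h1 : exp (-((t : ℂ) * e) / y) * b (t * e) * e - ∑ r ∈ Finset.range R,
        p r * e ^ (r + 1) * ((t : ℂ) ^ r * exp (-(a * t)))
        = exp (-(a * t)) * e * (b (t * e) - ∑ r ∈ Finset.range R, p r * (t * e) ^ r) := by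
      rw [hay, mul_sub, Finset.mul_sum]
      congr 1
      · ring
      · exact Finset.sum_congr rfl fun r _ => by ring
    rw [h1, norm_mul, norm_mul, hen, mul_one]
    have h2 := hC (t * e) ⟨t, ht, rfl⟩
    rw [norm_mul, hen, mul_one, norm_real, Real.norm_eq_abs, abs_of_pos ht] at h2
    have h3 : ‖exp (-(a * t))‖ = Real.exp (-(a.re * t)) := by
      simpa using norm_pow_mul_exp_neg a 0 ht
    rw [h3]
    calc _ ≤ Real.exp (-(a.re * t)) * (C * t ^ R) := by gcongr
      _ = _ := by ring
  · rw [MeasureTheory.integral_const_mul]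
    rw [integral_pow_mul_exp_neg ha0]
    calc C * (R.factorial / a.re ^ (R + 1)) ≤ C * (R.factorial / (κ / ‖y‖) ^ (R + 1)) := by gcongr
      _ = _ := by rw [div_pow]; field_simp

/-! ### Sectors -/

theorem isOpen_sector (θ c : ℝ) : IsOpen (sector θ c) := by
  refine isOpen_lt (by fun_prop) ?_
  exact continuous_re.comp (by fun_prop)

/-- A thin sector around a direction that is not imaginary stays away from the imaginary axis. -/
theorem exists_sector_re {θ : ℝ} (hθ : Real.cos θ ≠ 0) :
    ∃ c κ : ℝ, 0 < c ∧ c < 1 ∧ 0 < κ ∧ ∀ z ∈ sector θ c, κ * ‖z‖ ≤ |z.re| ∧ z.re ≠ 0 := by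
  -- With `c = √(1 - k²)`, the rotated point `w` has `|Im w| ≤ k‖z‖` and `Re w ≥ ‖z‖/2`. Hence `|Re
  -- z| ≥ 4k · ‖z‖/2 - k‖z‖ = k‖z‖`.
  set k : ℝ := |Real.cos θ| / 4 with hk
  have hk0 : 0 < k := by positivity
  have hk1 : k ≤ 1 / 4 := by
    have := Real.abs_cos_le_one θ
    rw [hk]; linarith
  set c : ℝ := Real.sqrt (1 - k ^ 2) with hc
  have hc2 : c ^ 2 = 1 - k ^ 2 := Real.sq_sqrt (by nlinarith)
  have hc0 : 0 ≤ c := Real.sqrt_nonneg _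
  have hch : 1 / 2 ≤ c := by nlinarith
  refine ⟨c, k, by linarith, by nlinarith, hk0, fun z hz => ?_⟩
  set w : ℂ := exp (-(θ : ℂ) * I) * z with hw
  have hz : c * ‖z‖ < w.re := hz
  have hzw : z = exp ((θ : ℂ) * I) * w := by
    rw [hw, ← mul_assoc, ← exp_add]; simp
  have hn : ‖w‖ = ‖z‖ := by
    rw [hw, norm_mul, ← ofReal_neg, norm_exp_ofReal_mul_I, one_mul]
  have hz0 : 0 < ‖z‖ := by
    refine norm_pos_iff.2 ?_
    rintro rfl
    simp [hw] at hz
  have hre : z.re = Real.cos θ * w.re - Real.sin θ * w.im := by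
    rw [hzw, exp_mul_I, ← ofReal_cos, ← ofReal_sin]
    simp [-ofReal_cos, -ofReal_sin]
  have him : |w.im| ≤ k * ‖z‖ := by
    refine abs_le_of_sq_le_sq ?_ (by positivity)
    have h1 : ‖z‖ ^ 2 = w.re ^ 2 + w.im ^ 2 := by
      rw [← hn, ← normSq_eq_norm_sq, normSq_apply]; ring
    have h2 : (c * ‖z‖) ^ 2 ≤ w.re ^ 2 := pow_le_pow_left₀ (by positivity) hz.le 2
    nlinarith
  have h3 : |Real.cos θ * w.re| - |Real.sin θ * w.im| ≤ |z.re| := by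
    rw [hre]; exact abs_sub_abs_le_abs_sub _ _
  rw [abs_mul, abs_mul, abs_of_pos (lt_of_le_of_lt (by positivity) hz)] at h3
  have h4 : |Real.sin θ| * |w.im| ≤ 1 * (k * ‖z‖) :=
    mul_le_mul (Real.abs_sin_le_one θ) him (abs_nonneg _) zero_le_one
  have h5 : |Real.cos θ| * (1 / 2 * ‖z‖) ≤ |Real.cos θ| * w.re := by
    gcongr
    nlinarith
  have h6 : k * ‖z‖ ≤ |z.re| := by
    have : |Real.cos θ| = 4 * k := by rw [hk]; ring
    nlinarith
  exact ⟨h6, fun h => by rw [h, abs_zero] at h6; nlinarith⟩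

/-! ### Abel summation -/

/-- Absolute summability of `c` makes `∑ P_d c_d` and `∑ P_d c_{d+1}` converge separately, `P_d`
being the bounded partial sums of `t`; shifting the index in one of them gives the identity. The
gain is that differences of `c` are smaller than `c`. -/
theorem hasSum_abel_summation {t c : ℕ → ℂ} {M : ℝ}
    (hM : ∀ d, ‖∑ j ∈ Finset.range (d + 1), t j‖ ≤ M) (hc : Summable fun d => ‖c d‖) {S : ℂ}
    (hS : HasSum (fun d => t d * c d) S) :
    HasSum (fun d => (∑ j ∈ Finset.range (d + 1), t j) * (c d - c (d + 1))) S := by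
  set P : ℕ → ℂ := fun d => ∑ j ∈ Finset.range (d + 1), t j with hP
  have h1 : Summable fun d => P d * c d :=
    Summable.of_norm_bounded (hc.mul_left M) fun d => by
      rw [norm_mul]; gcongr; exact hM d
  have h2 : Summable fun d => P d * c (d + 1) :=
    Summable.of_norm_bounded (((summable_nat_add_iff 1).2 hc).mul_left M) fun d => by
      rw [norm_mul]; gcongr; exact hM d
  have h3 : HasSum (fun d => P (d + 1) * c (d + 1)) (∑' d, P d * c d - P 0 * c 0) := by
    simpa using (hasSum_nat_add_iff' 1).2 h1.hasSum
  have h4 : HasSum (fun d => t (d + 1) * c (d + 1))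
      (∑' d, P d * c d - P 0 * c 0 - ∑' d, P d * c (d + 1)) := by
    refine (h3.sub h2.hasSum).congr_fun fun d => ?_
    simp only [hP]
    rw [Finset.sum_range_succ _ (d + 1)]
    ring
  have h5 : HasSum (fun d => t (d + 1) * c (d + 1)) (S - t 0 * c 0) := by
    simpa using (hasSum_nat_add_iff' 1).2 hS
  have h6 := h4.unique h5
  have h7 : P 0 = t 0 := by simp [hP]
  rw [h7] at h6
  have h8 : S = ∑' d, P d * c d - ∑' d, P d * c (d + 1) := by linear_combination -h6
  rw [h8]
  exact (h1.hasSum.sub h2.hasSum).congr_fun fun d => by ring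

/-- Mean value inequality on the convex half-plane `Re z ≥ 0`, where the derivative of `exp (-z)`
has norm at most `1`. -/
theorem norm_one_sub_exp_neg_le {η : ℂ} (hη : 0 ≤ η.re) : ‖1 - exp (-η)‖ ≤ ‖η‖ := by
  have h := Convex.norm_image_sub_le_of_norm_deriv_le (f := fun z : ℂ => exp (-z)) (C := 1)
    (s := {z : ℂ | 0 ≤ z.re}) (x := η) (y := 0) (fun z _ => by fun_prop) (fun z hz => ?_)
    (convex_halfSpace_re_ge 0) hη (by simp)
  · simpa using h
  · have h1 : deriv (fun z : ℂ => exp (-z)) z = -exp (-z) := by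
      simpa using ((hasDerivAt_neg z).cexp).deriv
    rw [h1, norm_neg, norm_exp]
    simpa using hz

/-! ### Even functions given by Dirichlet series -/

/-- The function `β` is even off the imaginary axis, analytic at `0` and off the imaginary axis,
and given on the right half-plane by the series `∑_{d ≥ 1} t_{d-1} e^{-dη}` whose coefficients have
bounded partial sums. -/
structure IsEvenDirichlet (t : ℕ → ℂ) (β : ℂ → ℂ) : Prop where
  bdd : ∃ M : ℝ, ∀ d, ‖∑ j ∈ Finset.range (d + 1), t j‖ ≤ M
  analyticAt : AnalyticAt ℂ β 0
  differentiableOn : DifferentiableOn ℂ β {η | η.re ≠ 0}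
  even : ∀ η : ℂ, η.re ≠ 0 → β (-η) = β η
  hasSum : ∀ η : ℂ, 0 < η.re → HasSum (fun d : ℕ => t d * exp (-((d + 1 : ℂ) * η))) (β η)

theorem IsEvenDirichlet.add {t t' : ℕ → ℂ} {β β' : ℂ → ℂ} (h : IsEvenDirichlet t β)
    (h' : IsEvenDirichlet t' β') : IsEvenDirichlet (t + t') (β + β') := by
  obtain ⟨M, hM⟩ := h.bdd
  obtain ⟨M', hM'⟩ := h'.bdd
  refine ⟨⟨M + M', fun d => ?_⟩, h.analyticAt.add h'.analyticAt,
    h.differentiableOn.add h'.differentiableOn, fun η hη => ?_, fun η hη => ?_⟩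
  · simp only [Pi.add_apply, Finset.sum_add_distrib]
    exact (norm_add_le _ _).trans (add_le_add (hM d) (hM' d))
  · simp [h.even η hη, h'.even η hη]
  · exact ((h.hasSum η hη).add (h'.hasSum η hη)).congr_fun fun d => by
      simp [add_mul]

theorem norm_exp_neg_succ_mul (η : ℂ) (d : ℕ) :
    ‖exp (-((d + 1 : ℂ) * η))‖ = Real.exp (-η.re) * Real.exp (-η.re) ^ d := by
  rw [norm_exp, ← Real.exp_nat_mul, ← Real.exp_add]
  congr 1
  simp
  ring

theorem hasSum_norm_exp_neg {η : ℂ} (hη : 0 < η.re) :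
    HasSum (fun d : ℕ => ‖exp (-((d + 1 : ℂ) * η))‖)
      (Real.exp (-η.re) * (1 - Real.exp (-η.re))⁻¹) := by
  simp only [norm_exp_neg_succ_mul]
  exact (hasSum_geometric_of_lt_one (Real.exp_pos _).le (by simpa using hη)).mul_left _

theorem IsEvenDirichlet.hasSum_abel {t : ℕ → ℂ} {β : ℂ → ℂ} (h : IsEvenDirichlet t β) {η : ℂ}
    (hη : 0 < η.re) :
    HasSum (fun d : ℕ => (∑ j ∈ Finset.range (d + 1), t j) *
      ((1 - exp (-η)) * exp (-((d + 1 : ℂ) * η)))) (β η) := by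
  obtain ⟨M, hM⟩ := h.bdd
  refine (hasSum_abel_summation hM (hasSum_norm_exp_neg hη).summable (h.hasSum η hη)).congr_fun
    fun d => ?_
  rw [sub_mul, one_mul, ← exp_add]
  congr 4
  push_cast
  ring

/-- After Abel summation the factor `1 - e^{-η}` offsets the geometric sum: `‖β η‖ ≤ M ‖η‖ / (e^{Re
η} - 1) ≤ M ‖η‖ / Re η`. This bound is invariant under scaling of `η`, and evenness carries it to
the left half-plane. -/
theorem IsEvenDirichlet.exists_bound {t : ℕ → ℂ} {β : ℂ → ℂ} (h : IsEvenDirichlet t β) :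
    ∃ M : ℝ, 0 ≤ M ∧ ∀ κ : ℝ, 0 < κ → ∀ η : ℂ, κ * ‖η‖ ≤ |η.re| → η.re ≠ 0 → ‖β η‖ ≤ M / κ := by
  obtain ⟨M, hM⟩ := h.bdd
  have hM0 : 0 ≤ M := (norm_nonneg _).trans (hM 0)
  have key : ∀ κ : ℝ, 0 < κ → ∀ η : ℂ, κ * ‖η‖ ≤ |η.re| → 0 < η.re → ‖β η‖ ≤ M / κ := by
    intro κ hκ η h1 hη
    rw [abs_of_pos hη] at h1
    set u := η.re with hu
    have h2 := tsum_of_norm_bounded ((hasSum_norm_exp_neg hη).mul_left (M * ‖η‖))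
      (f := fun d : ℕ => (∑ j ∈ Finset.range (d + 1), t j) *
        ((1 - exp (-η)) * exp (-((d + 1 : ℂ) * η)))) fun d => by
        rw [norm_mul, norm_mul, ← mul_assoc]
        gcongr
        · exact hM d
        · exact norm_one_sub_exp_neg_le hη.le
    rw [(h.hasSum_abel hη).tsum_eq] at h2
    refine h2.trans ?_
    have h3 : Real.exp (-u) * (1 - Real.exp (-u))⁻¹ ≤ 1 / u := by
      have h4 : Real.exp (-u) < 1 := by simpa using hη
      have h5 : Real.exp (-u) * (1 + u) ≤ 1 := by
        calc Real.exp (-u) * (1 + u) ≤ Real.exp (-u) * Real.exp u := by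
              gcongr; linarith [Real.add_one_le_exp u]
          _ = 1 := by rw [← Real.exp_add]; simp
      rw [← div_eq_mul_inv, div_le_div_iff₀ (by linarith) hη]
      linarith
    calc M * ‖η‖ * (Real.exp (-u) * (1 - Real.exp (-u))⁻¹) ≤ M * ‖η‖ * (1 / u) := by gcongr
      _ = M * (‖η‖ / u) := by ring
      _ ≤ M * (1 / κ) := by
          gcongr M * ?_
          rw [div_le_div_iff₀ hη hκ]; linarith
      _ = M / κ := by ring
  refine ⟨M, hM0, fun κ hκ η h1 h2 => ?_⟩
  rcases lt_or_gt_of_ne h2 with h3 | h3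
  · rw [← h.even η h2]
    exact key κ hκ (-η) (by simpa using h1) (by simpa using h3)
  · exact key κ hκ η h1 h3

/-! ### The transform `∑_{ℓ ≥ 1} ℓ^{-2} β(ζ/ℓ)` -/

/-- The function `∑_{ℓ ≥ 1} ℓ^{-2} β(ζ/ℓ)`. -/
noncomputable def inverseSquareSum (β : ℂ → ℂ) (ζ : ℂ) : ℂ :=
  ∑' l : ℕ, 1 / (l + 1 : ℂ) ^ 2 * β (ζ / (l + 1 : ℂ))

theorem summable_inverse_square : Summable fun l : ℕ => 1 / ((l : ℝ) + 1) ^ 2 := by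
  have := (summable_nat_add_iff 1).2 (Real.summable_one_div_nat_pow.2 (one_lt_two))
  simpa using this

theorem norm_inverse_square_mul_le {l : ℕ} {z : ℂ} {B : ℝ} (h : ‖z‖ ≤ B) :
    ‖1 / (l + 1 : ℂ) ^ 2 * z‖ ≤ B * (1 / ((l : ℝ) + 1) ^ 2) := by
  have h1 : ‖(l + 1 : ℂ)‖ = (l : ℝ) + 1 := by exact_mod_cast norm_natCast (l + 1)
  rw [norm_mul, norm_div, norm_one, norm_pow, h1, mul_comm]
  gcongr

theorem div_succ_re (ζ : ℂ) (l : ℕ) : (ζ / (l + 1 : ℂ)).re = ζ.re / ((l : ℝ) + 1) := by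
  have : (l + 1 : ℂ) = ((l + 1 : ℝ) : ℂ) := by push_cast; rfl
  rw [this, div_ofReal_re]

theorem norm_div_succ (ζ : ℂ) (l : ℕ) : ‖ζ / (l + 1 : ℂ)‖ = ‖ζ‖ / ((l : ℝ) + 1) := by
  have h1 : ‖(l + 1 : ℂ)‖ = (l : ℝ) + 1 := by exact_mod_cast norm_natCast (l + 1)
  rw [norm_div, h1]

theorem inverseSquareSum_differentiableOn {β : ℂ → ℂ} {U V : Set ℂ} (hβ : DifferentiableOn ℂ β V)
    (hU : IsOpen U) (hUV : ∀ l : ℕ, ∀ ζ ∈ U, ζ / (l + 1 : ℂ) ∈ V) {B : ℝ}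
    (hB : ∀ l : ℕ, ∀ ζ ∈ U, ‖β (ζ / (l + 1 : ℂ))‖ ≤ B) :
    DifferentiableOn ℂ (inverseSquareSum β) U := by
  refine differentiableOn_tsum_of_summable_norm (summable_inverse_square.mul_left B)
    (fun l => ?_) hU fun l ζ hζ => norm_inverse_square_mul_le (hB l ζ hζ)
  refine DifferentiableOn.const_mul ?_ _
  exact hβ.comp (by fun_prop) fun ζ hζ => hUV l ζ hζ

theorem IsEvenDirichlet.inverseSquareSum_analyticAt {t : ℕ → ℂ} {β : ℂ → ℂ}
    (h : IsEvenDirichlet t β) : AnalyticAt ℂ (inverseSquareSum β) 0 := by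
  have h1 := h.analyticAt.eventually_analyticAt
  have h2 : ∀ᶠ ζ in 𝓝 (0 : ℂ), ‖β ζ‖ < ‖β 0‖ + 1 :=
    h.analyticAt.continuousAt.norm.eventually_lt continuousAt_const (by simp)
  obtain ⟨r, hr, hs⟩ := Metric.nhds_basis_ball.eventually_iff.1 (h1.and h2)
  have h3 : ∀ l : ℕ, ∀ ζ ∈ Metric.ball (0 : ℂ) r, ζ / (l + 1 : ℂ) ∈ Metric.ball (0 : ℂ) r := by
    intro l ζ hζ
    rw [mem_ball_zero_iff] at hζ ⊢
    rw [norm_div_succ]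
    exact (div_le_self (norm_nonneg _) (by simp)).trans_lt hζ
  have h4 : DifferentiableOn ℂ (inverseSquareSum β) (Metric.ball 0 r) :=
    inverseSquareSum_differentiableOn (V := Metric.ball 0 r)
      (fun ζ hζ => (hs hζ).1.differentiableAt.differentiableWithinAt) Metric.isOpen_ball h3
      fun l ζ hζ => (hs (h3 l ζ hζ)).2.le
  exact h4.analyticAt (Metric.ball_mem_nhds 0 hr)

theorem IsEvenDirichlet.inverseSquareSum_neg {t : ℕ → ℂ} {β : ℂ → ℂ} (h : IsEvenDirichlet t β)
    {ζ : ℂ} (hζ : ζ.re ≠ 0) : inverseSquareSum β (-ζ) = inverseSquareSum β ζ := by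
  refine tsum_congr fun l => ?_
  rw [neg_div, h.even]
  rw [div_succ_re]
  exact div_ne_zero hζ (by positivity)

/-- The bound on `β` is scale invariant, hence the same at every `ζ/ℓ`, and the weights `ℓ^{-2}` are
summable. -/
theorem IsEvenDirichlet.exists_sector {t : ℕ → ℂ} {β : ℂ → ℂ} (h : IsEvenDirichlet t β) {θ : ℝ}
    (hθ : Real.cos θ ≠ 0) :
    ∃ c B : ℝ, 0 < c ∧ c < 1 ∧ DifferentiableOn ℂ (inverseSquareSum β) (sector θ c) ∧
      ∀ ζ ∈ sector θ c, ‖inverseSquareSum β ζ‖ ≤ B := by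
  obtain ⟨c, κ, hc0, hc1, hκ, hs⟩ := exists_sector_re hθ
  obtain ⟨M, hM0, hM⟩ := h.exists_bound
  have h1 : ∀ l : ℕ, ∀ ζ ∈ sector θ c, (ζ / (l + 1 : ℂ)).re ≠ 0 := by
    intro l ζ hζ
    rw [div_succ_re]
    exact div_ne_zero (hs ζ hζ).2 (by positivity)
  have h2 : ∀ l : ℕ, ∀ ζ ∈ sector θ c, ‖β (ζ / (l + 1 : ℂ))‖ ≤ M / κ := by
    intro l ζ hζ
    refine hM κ hκ _ ?_ (h1 l ζ hζ)
    have hl : (0 : ℝ) < l + 1 := by positivity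
    rw [div_succ_re, norm_div_succ, abs_div, abs_of_pos hl, ← mul_div_assoc]
    have := (hs ζ hζ).1
    gcongr
  refine ⟨c, M / κ * ∑' l : ℕ, 1 / ((l : ℝ) + 1) ^ 2, hc0, hc1, inverseSquareSum_differentiableOn h.differentiableOn
    (isOpen_sector θ c) h1 h2, fun ζ hζ => ?_⟩
  exact tsum_of_norm_bounded (summable_inverse_square.hasSum.mul_left (M / κ))
    fun l => norm_inverse_square_mul_le (h2 l ζ hζ)

/-! ### The Laplace integral as a double series -/

theorem summable_three_halves : Summable fun l : ℕ => 1 / (((l : ℝ) + 1) * √((l : ℝ) + 1)) := by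
  have h := (summable_nat_add_iff 1).2
    (Real.summable_one_div_nat_rpow.2 (by norm_num : (1 : ℝ) < 3 / 2))
  refine h.congr fun l => ?_
  have h0 : (0 : ℝ) < l + 1 := by positivity
  push_cast
  rw [Real.sqrt_eq_rpow, ← Real.rpow_one_add' h0.le (by norm_num)]
  norm_num

theorem summable_three_halves_prod :
    Summable fun p : ℕ × ℕ => 1 / (((p.1 : ℝ) + 1) * √((p.1 : ℝ) + 1)) *
      (1 / (((p.2 : ℝ) + 1) * √((p.2 : ℝ) + 1))) :=
  summable_three_halves.mul_of_nonneg summable_three_halves (fun _ => by positivity)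
    fun _ => by positivity

/-- Comparing squares keeps the exponents integral; the exponent `3/2` in each variable makes the
majorant a product of two convergent series. -/
theorem le_three_halves_of_sq_le {X K : ℝ} (hK : 0 ≤ K) {l d : ℕ}
    (h : X ^ 2 ≤ K ^ 2 / (((l : ℝ) + 1) ^ 3 * ((d : ℝ) + 1) ^ 3)) :
    X ≤ K * (1 / (((l : ℝ) + 1) * √((l : ℝ) + 1)) * (1 / (((d : ℝ) + 1) * √((d : ℝ) + 1)))) := by
  refine le_of_sq_le_sq (h.trans_eq ?_) (by positivity)
  have hl : (0 : ℝ) ≤ l + 1 := by positivity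
  have hd : (0 : ℝ) ≤ d + 1 := by positivity
  simp only [mul_pow, div_pow, one_pow, Real.sq_sqrt hl, Real.sq_sqrt hd]
  field_simp

theorem exp_neg_sq_le {s : ℝ} (hs : 0 < s) : Real.exp (-s) ^ 2 ≤ 2 / s ^ 3 := by
  have h1 : s ≤ Real.exp s := by linarith [Real.add_one_le_exp s]
  have h2 : s ^ 2 / 2 ≤ Real.exp s := by
    have := Real.quadratic_le_exp_of_nonneg hs.le
    linarith
  have h3 : s * (s ^ 2 / 2) ≤ Real.exp s * Real.exp s :=
    mul_le_mul h1 h2 (by positivity) (Real.exp_pos s).le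
  rw [Real.exp_neg, inv_pow, inv_eq_one_div, div_le_div_iff₀ (by positivity) (by positivity)]
  nlinarith

/-- The terms of the double series representing the Laplace integral of
`∑_{ℓ ≥ 1} ℓ^{-2} β(ζ/ℓ)`. -/
noncomputable def laplaceTerm (t : ℕ → ℂ) (y : ℂ) (p : ℕ × ℕ) : ℂ :=
  (∑ j ∈ Finset.range (p.2 + 1), t j) / (p.1 + 1 : ℂ) *
    (1 / ((p.1 + 1 : ℂ) / y + (p.2 + 1)) - 1 / ((p.1 + 1 : ℂ) / y + (p.2 + 2)))

/-- Termwise, `ℓ^{-2} e^{-ζ/y} e^{-dζ/ℓ}` integrates to `1 / (ℓ (ℓ/y + d))`, whose sum over `d`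
diverges logarithmically in absolute value. In Abel form the terms have size `1 / (ℓ (ℓ + d)²)`, so
sum and integral may be exchanged. -/
theorem IsEvenDirichlet.hasSum_laplaceTerm {t : ℕ → ℂ} {β : ℂ → ℂ} (h : IsEvenDirichlet t β)
    {θ : ℝ} (hθ : 0 < Real.cos θ) {y : ℂ} (hy : 0 < (exp ((θ : ℂ) * I) / y).re) :
    HasSum (laplaceTerm t y) (∫ x in Set.Ioi (0 : ℝ),
        exp (-((x : ℂ) * exp ((θ : ℂ) * I)) / y) * inverseSquareSum β ((x : ℂ) * exp ((θ : ℂ) * I))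
          * exp ((θ : ℂ) * I)) := by
  set e : ℂ := exp ((θ : ℂ) * I) with he
  have hen : ‖e‖ = 1 := norm_exp_ofReal_mul_I θ
  have he0 : e ≠ 0 := exp_ne_zero _
  have hy0 : y ≠ 0 := by rintro rfl; simp at hy
  set κ : ℝ := Real.cos θ with hκ
  have hek : e.re = κ := by rw [he, exp_ofReal_mul_I_re]
  set q : ℝ := (e / y).re with hq
  obtain ⟨M, hM⟩ := h.bdd
  have hM0 : 0 ≤ M := (norm_nonneg _).trans (hM 0)
  set P : ℕ → ℂ := fun d => ∑ j ∈ Finset.range (d + 1), t j with hP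
  have hl0 : ∀ l : ℕ, (0 : ℝ) < l + 1 := fun l => by positivity
  have hlc : ∀ l : ℕ, (l + 1 : ℂ) ≠ 0 := fun l => Nat.cast_add_one_ne_zero l
  set F : ℕ × ℕ → ℝ → ℂ := fun p x => exp (-((x : ℂ) * e) / y) *
    (1 / (p.1 + 1 : ℂ) ^ 2 * (P p.2 * ((1 - exp (-((x * e) / (p.1 + 1 : ℂ)))) *
      exp (-((p.2 + 1 : ℂ) * ((x * e) / (p.1 + 1 : ℂ))))))) * e with hF
  have hxre : ∀ (x : ℝ) (l : ℕ), ((x * e) / (l + 1 : ℂ)).re = κ * (x / (l + 1)) := by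
    intro x l
    rw [div_succ_re, re_ofReal_mul, hek]; ring
  have hbound : ∀ (p : ℕ × ℕ) (x : ℝ), 0 < x → ‖F p x‖ ≤ M / ((p.1 : ℝ) + 1) ^ 3 *
      (x * (Real.exp (-(q * x)) * Real.exp (-((p.2 + 1) * (κ * (x / (p.1 + 1))))))) := by
    rintro ⟨l, d⟩ x hx
    have h1 : ‖1 - exp (-((x * e) / (l + 1 : ℂ)))‖ ≤ x / (l + 1) := by
      refine (norm_one_sub_exp_neg_le ?_).trans ?_
      · rw [hxre]; positivity
      · rw [norm_div_succ, norm_mul, hen, norm_real, Real.norm_eq_abs, abs_of_pos hx, mul_one]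
    have h2 : ‖exp (-((x : ℂ) * e) / y)‖ = Real.exp (-(q * x)) := by
      rw [norm_exp]
      have : -((x : ℂ) * e) / y = -(x * (e / y)) := by ring
      rw [this, neg_re, re_ofReal_mul, mul_comm]
    have h3 : ‖exp (-((d + 1 : ℂ) * ((x * e) / (l + 1 : ℂ))))‖
        = Real.exp (-((d + 1) * (κ * (x / (l + 1))))) := by
      have : (d + 1 : ℂ) = ((d + 1 : ℝ) : ℂ) := by push_cast; rfl
      rw [norm_exp, neg_re, this, re_ofReal_mul, hxre]
    have h4 : ‖1 / (l + 1 : ℂ) ^ 2‖ = 1 / ((l : ℝ) + 1) ^ 2 := by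
      have h1 : ‖(l + 1 : ℂ)‖ = (l : ℝ) + 1 := by exact_mod_cast norm_natCast (l + 1)
      rw [norm_div, norm_one, norm_pow, h1]
    simp only [hF]
    rw [norm_mul, norm_mul, norm_mul, norm_mul, norm_mul, h2, h3, h4, hen, mul_one]
    calc _ ≤ Real.exp (-(q * x)) * (1 / ((l : ℝ) + 1) ^ 2 * (M * (x / (l + 1) *
        Real.exp (-((d + 1) * (κ * (x / (l + 1)))))))) := by
          gcongr
          exact hM d
      _ = _ := by field_simp
  have hFcont : ∀ p, Continuous (F p) := fun p => by simp only [hF]; fun_prop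
  have hcomb : ∀ (p : ℕ × ℕ) (x : ℝ), M / ((p.1 : ℝ) + 1) ^ 3 *
      (x * (Real.exp (-(q * x)) * Real.exp (-((p.2 + 1) * (κ * (x / (p.1 + 1)))))))
      = M / ((p.1 : ℝ) + 1) ^ 3 * (x ^ 1 *
        Real.exp (-((q + (p.2 + 1) * κ / (p.1 + 1)) * x))) := by
    intro p x
    rw [← Real.exp_add, pow_one]
    congr 3
    ring_nf
  have hqp : ∀ p : ℕ × ℕ, 0 < q + ((p.2 : ℝ) + 1) * κ / (p.1 + 1) := fun p => by positivity
  have hdom : ∀ p : ℕ × ℕ, MeasureTheory.IntegrableOn (fun x : ℝ => M / ((p.1 : ℝ) + 1) ^ 3 *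
      (x ^ 1 * Real.exp (-((q + (p.2 + 1) * κ / (p.1 + 1)) * x)))) (Set.Ioi 0) :=
    fun p => (integrableOn_pow_mul_exp_neg (hqp p) 1).const_mul _
  have hbound' : ∀ p : ℕ × ℕ, ∀ᵐ x ∂(MeasureTheory.volume.restrict (Set.Ioi (0 : ℝ))),
      ‖F p x‖ ≤ M / ((p.1 : ℝ) + 1) ^ 3 *
      (x ^ 1 * Real.exp (-((q + (p.2 + 1) * κ / (p.1 + 1)) * x))) := by
    intro p
    filter_upwards [MeasureTheory.ae_restrict_mem measurableSet_Ioi] with x hx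
    rw [← hcomb]
    exact hbound p x hx
  have hint : ∀ p, MeasureTheory.IntegrableOn (F p) (Set.Ioi 0) := fun p =>
    MeasureTheory.Integrable.mono' (hdom p) (hFcont p).aestronglyMeasurable (hbound' p)
  have hsumnorm : Summable fun p => ∫ x in Set.Ioi (0 : ℝ), ‖F p x‖ := by
    set K : ℝ := M * √(1 / (q * κ ^ 3)) with hK
    have hK0 : 0 ≤ K := by positivity
    refine Summable.of_nonneg_of_le
      (fun p => MeasureTheory.integral_nonneg fun _ => norm_nonneg _) (fun p => ?_)
      (summable_three_halves_prod.mul_left K)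
    refine le_three_halves_of_sq_le hK0 ?_
    have h1 : ∫ x in Set.Ioi (0 : ℝ), ‖F p x‖ ≤
        M / ((p.1 : ℝ) + 1) ^ 3 * (1 / (q + (p.2 + 1) * κ / (p.1 + 1)) ^ 2) := by
      refine (MeasureTheory.integral_mono_ae (hint p).norm (hdom p) (hbound' p)).trans_eq ?_
      rw [MeasureTheory.integral_const_mul, integral_pow_mul_exp_neg (hqp p)]
      simp
    have h2 : M / ((p.1 : ℝ) + 1) ^ 3 * (1 / (q + (p.2 + 1) * κ / (p.1 + 1)) ^ 2)
        = M / ((p.1 + 1) * (q * (p.1 + 1) + κ * (p.2 + 1)) ^ 2) := by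
      have := hl0 p.1
      have : q * (p.1 + 1) + κ * (p.2 + 1) ≠ 0 := by positivity
      have h3 : q + (p.2 + 1) * κ / (p.1 + 1) = (q * (p.1 + 1) + κ * (p.2 + 1)) / (p.1 + 1) := by
        field_simp
      rw [h3, div_pow]
      field_simp
    rw [h2] at h1
    refine (pow_le_pow_left₀ (MeasureTheory.integral_nonneg fun _ => norm_nonneg _) h1 2).trans ?_
    -- With `ℓ = p.1 + 1` and `d = p.2 + 1`, one of the four factors is bounded below by `qℓ` and
    -- three by `κd`. With the prefactor `ℓ²` of the squared denominator this makes `ℓ³ d³`.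
    have h4 : (q * (p.1 + 1)) * (κ * (p.2 + 1)) ^ 3 ≤ (q * (p.1 + 1) + κ * (p.2 + 1)) ^ 4 := by
      have ha : 0 ≤ q * ((p.1 : ℝ) + 1) := by positivity
      have hb : 0 ≤ κ * ((p.2 : ℝ) + 1) := by positivity
      calc _ ≤ (q * (p.1 + 1) + κ * (p.2 + 1)) * (q * (p.1 + 1) + κ * (p.2 + 1)) ^ 3 := by
            gcongr <;> linarith
        _ = _ := by ring
    rw [hK, mul_pow, Real.sq_sqrt (by positivity), div_pow, mul_pow, ← pow_mul]
    rw [mul_one_div, div_div]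
    refine div_le_div_of_nonneg_left (by positivity) (by positivity) ?_
    calc q * κ ^ 3 * (((p.1 : ℝ) + 1) ^ 3 * (p.2 + 1) ^ 3)
        = (p.1 + 1) ^ 2 * ((q * (p.1 + 1)) * (κ * (p.2 + 1)) ^ 3) := by ring
      _ ≤ (p.1 + 1) ^ 2 * (q * (p.1 + 1) + κ * (p.2 + 1)) ^ (2 * 2) := by gcongr
  have hpt : ∀ x : ℝ, 0 < x → ∑' p, F p x
      = exp (-((x : ℂ) * e) / y) * inverseSquareSum β ((x : ℂ) * e) * e := by
    intro x hx
    have hs : Summable fun p => F p x := by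
      -- From `exp_neg_sq_le` at `s = dκx/ℓ`: its `ℓ³ / d³` turns the squared prefactor `ℓ^{-6}`
      -- into `ℓ^{-3} d^{-3}`.
      set K : ℝ := M * x * √(2 / (κ * x) ^ 3) with hK
      have hK0 : 0 ≤ K := by positivity
      refine Summable.of_norm_bounded (summable_three_halves_prod.mul_left K) fun p => ?_
      refine le_three_halves_of_sq_le hK0 ?_
      refine (pow_le_pow_left₀ (norm_nonneg _) (hbound p x hx) 2).trans ?_
      have h1 : Real.exp (-(q * x)) ≤ 1 := by
        rw [Real.exp_le_one_iff]
        have : 0 < q * x := mul_pos hy hx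
        linarith
      have h2 := exp_neg_sq_le (s := (p.2 + 1) * (κ * (x / (p.1 + 1)))) (by
        have := hl0 p.1; positivity)
      calc _ ≤ (M / ((p.1 : ℝ) + 1) ^ 3 * (x * (1 *
            Real.exp (-((p.2 + 1) * (κ * (x / (p.1 + 1)))))))) ^ 2 := by
            gcongr
        _ = (M / ((p.1 : ℝ) + 1) ^ 3 * x) ^ 2 *
            Real.exp (-((p.2 + 1) * (κ * (x / (p.1 + 1))))) ^ 2 := by ring
        _ ≤ (M / ((p.1 : ℝ) + 1) ^ 3 * x) ^ 2 * (2 / ((p.2 + 1) * (κ * (x / (p.1 + 1)))) ^ 3) := by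
            gcongr
        _ = _ := by
            rw [hK, mul_pow (M * x), Real.sq_sqrt (by positivity)]
            field_simp
    rw [hs.tsum_prod, inverseSquareSum, ← tsum_mul_left, ← tsum_mul_right]
    refine tsum_congr fun l => ?_
    have h1 := h.hasSum_abel (η := (x * e) / (l + 1 : ℂ)) (by
      rw [hxre]; have := hl0 l; positivity)
    rw [← h1.tsum_eq, ← tsum_mul_left, ← tsum_mul_left, ← tsum_mul_right]
  have hval : ∀ p, ∫ x in Set.Ioi (0 : ℝ), F p x = laplaceTerm t y p := by
    rintro ⟨l, d⟩
    set a₁ : ℂ := e / y + (d + 1) * e / (l + 1) with ha₁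
    set a₂ : ℂ := e / y + (d + 2) * e / (l + 1) with ha₂
    have hr : ∀ c : ℝ, 0 < c → 0 < (e / y + c * e / (l + 1 : ℂ)).re := by
      intro c hc
      rw [add_re, div_succ_re, re_ofReal_mul, hek]
      have := hl0 l
      positivity
    have hr₁ : 0 < a₁.re := by
      have := hr (d + 1) (by positivity)
      push_cast at this; exact this
    have hr₂ : 0 < a₂.re := by
      have := hr (d + 2) (by positivity)
      push_cast at this; exact this
    have h1 : ∀ x : ℝ, F (l, d) x = 1 / (l + 1 : ℂ) ^ 2 * P d * e *
        ((x : ℂ) ^ 0 * exp (-(a₁ * x)) - (x : ℂ) ^ 0 * exp (-(a₂ * x))) := by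
      intro x
      have e1 : exp (-(a₁ * x)) = exp (-((x : ℂ) * e) / y) *
          exp (-((d + 1 : ℂ) * ((x * e) / (l + 1 : ℂ)))) := by
        rw [← exp_add, ha₁]; congr 1; ring
      have e2 : exp (-(a₂ * x)) = exp (-((x : ℂ) * e) / y) *
          (exp (-((x * e) / (l + 1 : ℂ))) * exp (-((d + 1 : ℂ) * ((x * e) / (l + 1 : ℂ))))) := by
        rw [← exp_add, ← exp_add, ha₂]; congr 1; ring
      rw [e1, e2]
      simp only [hF]
      ring
    simp only [h1]
    rw [MeasureTheory.integral_const_mul, MeasureTheory.integral_sub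
      (integrableOn_pow_mul_cexp_neg hr₁ 0) (integrableOn_pow_mul_cexp_neg hr₂ 0),
      integral_pow_mul_cexp_neg hr₁, integral_pow_mul_cexp_neg hr₂]
    have hs1 : a₁ = e * ((l + 1 : ℂ) / y + (d + 1)) / (l + 1) := by
      rw [ha₁]; have := hlc l; field_simp
    have hs2 : a₂ = e * ((l + 1 : ℂ) / y + (d + 2)) / (l + 1) := by
      rw [ha₂]; have := hlc l; field_simp
    have hn1 : (l + 1 : ℂ) / y + (d + 1) ≠ 0 := fun h0 => by
      rw [hs1, h0] at hr₁; simp at hr₁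
    have hn2 : (l + 1 : ℂ) / y + (d + 2) ≠ 0 := fun h0 => by
      rw [hs2, h0] at hr₂; simp at hr₂
    simp only [laplaceTerm]
    rw [hs1, hs2]
    have := hlc l
    generalize (l + 1 : ℂ) / y + (d + 1) = A at hn1
    generalize (l + 1 : ℂ) / y + (d + 2) = B at hn2
    simp only [hP, Nat.factorial_zero, Nat.cast_one, zero_add, pow_one]
    field_simp
  have hmain := MeasureTheory.hasSum_integral_of_summable_integral_norm hint hsumnorm
  simp only [hval] at hmain
  have hfin := MeasureTheory.setIntegral_congr_fun (μ := MeasureTheory.volume) measurableSet_Ioi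
    fun x (hx : x ∈ Set.Ioi (0 : ℝ)) => hpt x hx
  rwa [hfin] at hmain

/-! ### The cotangent expansion and the median identity -/

/-- `q^{d+1} / (1 - q^{d+1})` with `q = e^{2πiy}`. -/
noncomputable def lambertQ (y : ℂ) (d : ℕ) : ℂ :=
  exp (2 * Real.pi * I * ((d + 1 : ℂ) * y)) / (1 - exp (2 * Real.pi * I * ((d + 1 : ℂ) * y)))

theorem norm_exp_two_pi_I_succ_mul (y : ℂ) (d : ℕ) :
    ‖exp (2 * Real.pi * I * ((d + 1 : ℂ) * y))‖ = Real.exp (-(2 * Real.pi * y.im)) ^ (d + 1) := by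
  rw [norm_exp, ← Real.exp_nat_mul]
  congr 1
  simp
  ring

theorem exp_neg_two_pi_mul_lt_one {y : ℂ} (hy : 0 < y.im) :
    Real.exp (-(2 * Real.pi * y.im)) < 1 := by
  rw [Real.exp_lt_one_iff]
  have := Real.pi_pos
  have : 0 < 2 * Real.pi * y.im := by positivity
  linarith

theorem norm_exp_two_pi_I_succ_mul_le {y : ℂ} (hy : 0 < y.im) (d : ℕ) :
    ‖exp (2 * Real.pi * I * ((d + 1 : ℂ) * y))‖ ≤ Real.exp (-(2 * Real.pi * y.im)) := by
  rw [norm_exp_two_pi_I_succ_mul]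
  exact pow_le_of_le_one (Real.exp_pos _).le (exp_neg_two_pi_mul_lt_one hy).le (by omega)

theorem one_sub_exp_two_pi_I_ne_zero {y : ℂ} (hy : 0 < y.im) (d : ℕ) :
    1 - exp (2 * Real.pi * I * ((d + 1 : ℂ) * y)) ≠ 0 := by
  intro h
  have h1 := (norm_exp_two_pi_I_succ_mul_le hy d).trans_lt (exp_neg_two_pi_mul_lt_one hy)
  rw [← sub_eq_zero.1 h] at h1
  simp at h1

theorem summable_norm_lambertQ {y : ℂ} (hy : 0 < y.im) : Summable fun d => ‖lambertQ y d‖ := by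
  set r := Real.exp (-(2 * Real.pi * y.im)) with hr
  have hr1 : r < 1 := exp_neg_two_pi_mul_lt_one hy
  have hr0 : 0 ≤ r := (Real.exp_pos _).le
  refine Summable.of_nonneg_of_le (fun _ => norm_nonneg _) (fun d => ?_)
    (((summable_nat_add_iff 1).2 (summable_geometric_of_lt_one hr0 hr1)).div_const (1 - r))
  rw [lambertQ, norm_div, norm_exp_two_pi_I_succ_mul]
  have h1 : 1 - r ≤ ‖1 - exp (2 * Real.pi * I * ((d + 1 : ℂ) * y))‖ := by
    have h2 := norm_sub_norm_le (1 : ℂ) (exp (2 * Real.pi * I * ((d + 1 : ℂ) * y)))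
    rw [norm_one] at h2
    linarith [norm_exp_two_pi_I_succ_mul_le hy d]
  have : 0 < 1 - r := by linarith
  gcongr

theorem pi_mul_cot_eq_lambertQ {y : ℂ} (hy : 0 < y.im) (d : ℕ) :
    (Real.pi : ℂ) * cot (Real.pi * ((d + 1 : ℂ) * y))
      = -(Real.pi * I) - 2 * Real.pi * I * lambertQ y d := by
  have h := one_sub_exp_two_pi_I_ne_zero hy d
  rw [cot_pi_eq_exp_ratio, lambertQ]
  generalize exp (2 * Real.pi * I * ((d + 1 : ℂ) * y)) = E at h
  have h1 : (1 : ℂ) / I = -I := by simp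
  calc (Real.pi : ℂ) * ((E + 1) / (I * (1 - E))) = Real.pi * (1 / I) * ((E + 1) / (1 - E)) := by
        field_simp
    _ = _ := by rw [h1]; field_simp; ring

theorem norm_succ (d : ℕ) : ‖(d + 1 : ℂ)‖ = (d : ℝ) + 1 := by
  exact_mod_cast norm_natCast (d + 1)

theorem summable_one_div_succ_sub :
    Summable fun d : ℕ => ‖1 / (d + 1 : ℂ) - 1 / (d + 2 : ℂ)‖ := by
  refine Summable.of_nonneg_of_le (fun _ => norm_nonneg _) (fun d => ?_) summable_inverse_square
  have h1 : (d + 1 : ℂ) ≠ 0 := Nat.cast_add_one_ne_zero d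
  have h2 : (d + 2 : ℂ) ≠ 0 := by exact_mod_cast (by omega : d + 2 ≠ 0)
  have h3 : ‖(d + 2 : ℂ)‖ = (d : ℝ) + 2 := by exact_mod_cast norm_natCast (d + 2)
  have h4 : 1 / (d + 1 : ℂ) - 1 / (d + 2 : ℂ) = 1 / ((d + 1) * (d + 2)) := by
    field_simp; ring
  rw [h4, norm_div, norm_one, norm_mul, norm_succ, h3, pow_two]
  gcongr
  linarith

/-- The constant `∑_{d ≥ 1} t_{d-1} / d`, written as an absolutely convergent series. -/
noncomputable def abelSum (t : ℕ → ℂ) : ℂ :=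
  ∑' d : ℕ, (∑ j ∈ Finset.range (d + 1), t j) * (1 / (d + 1 : ℂ) - 1 / (d + 2 : ℂ))

/-- The constant `∑_{d ≥ 1} t_{d-1} / d²`. -/
noncomputable def squareSum (t : ℕ → ℂ) : ℂ :=
  ∑' d : ℕ, t d / (d + 1 : ℂ) ^ 2

/-- The Lambert series `∑_{d ≥ 1} (t_{d-1} / d) q^d / (1 - q^d)` with `q = e^{2πiy}`. -/
noncomputable def lambertSeries (t : ℕ → ℂ) (y : ℂ) : ℂ :=
  ∑' d : ℕ, t d / (d + 1 : ℂ) * lambertQ y d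

theorem IsEvenDirichlet.bdd_coeff {t : ℕ → ℂ} {β : ℂ → ℂ} (h : IsEvenDirichlet t β) :
    ∃ M : ℝ, ∀ d, ‖t d‖ ≤ M := by
  obtain ⟨M, hM⟩ := h.bdd
  have hM0 : 0 ≤ M := (norm_nonneg _).trans (hM 0)
  refine ⟨M + M, fun d => ?_⟩
  have h1 : t d = ∑ j ∈ Finset.range (d + 1), t j - ∑ j ∈ Finset.range d, t j := by
    rw [Finset.sum_range_succ]; ring
  rw [h1]
  refine (norm_sub_le _ _).trans (add_le_add (hM d) ?_)
  rcases d with _ | d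
  · simpa using hM0
  · exact hM d

/-- With `d` for the shifted index and `z = dy`, the summand is `-(1/d) (1/(z - ℓ) + 1/(z + ℓ))`.
The partial fractions of the cotangent sum it to `-(1/d) (π cot(πz) - 1/z)`. -/
theorem hasSum_laplaceTerm_kernel {y : ℂ} (hy : 0 < y.im) (d : ℕ) :
    HasSum (fun l : ℕ => 1 / (l + 1 : ℂ) * (1 / ((l + 1 : ℂ) / y + (d + 1))
        - 1 / ((l + 1 : ℂ) / -y + (d + 1))))
      (Real.pi * I * (1 / (d + 1 : ℂ)) + (2 * Real.pi * I * (lambertQ y d / (d + 1 : ℂ))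
        + 1 / y * (1 / (d + 1 : ℂ) ^ 2))) := by
  have hd : (d + 1 : ℂ) ≠ 0 := Nat.cast_add_one_ne_zero d
  have hy0 : y ≠ 0 := by rintro rfl; simp at hy
  set z : ℂ := (d + 1 : ℂ) * y with hz
  have hzim : 0 < z.im := by
    have : (d + 1 : ℂ) = ((d + 1 : ℝ) : ℂ) := by push_cast; rfl
    rw [hz, this, im_ofReal_mul]; positivity
  have hzc : z ∈ integerComplement := UpperHalfPlane.coe_mem_integerComplement ⟨z, hzim⟩
  have h1 : HasSum (fun l : ℕ => 1 / (z - (l + 1)) + 1 / (z + (l + 1)))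
      (Real.pi * cot (Real.pi * z) - 1 / z) := by
    rw [cot_series_rep' hzc]
    exact (summable_cotTerm hzc).hasSum
  rw [hz, pi_mul_cot_eq_lambertQ hy d] at h1
  have h4 : -(1 / (d + 1 : ℂ)) * (-(Real.pi * I) - 2 * Real.pi * I * lambertQ y d - 1 / z)
      = Real.pi * I * (1 / (d + 1 : ℂ)) + (2 * Real.pi * I * (lambertQ y d / (d + 1 : ℂ))
        + 1 / y * (1 / (d + 1 : ℂ) ^ 2)) := by
    rw [hz]
    field_simp
    ring
  rw [← h4]
  refine (h1.mul_left (-(1 / (d + 1 : ℂ)))).congr_fun fun l => ?_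
  have hl : (l + 1 : ℂ) ≠ 0 := Nat.cast_add_one_ne_zero l
  have h2 : z - (l + 1) ≠ 0 := fun h0 => by
    have := congrArg im h0; simp at this; linarith
  have h3 : z + (l + 1) ≠ 0 := fun h0 => by
    have := congrArg im h0; simp at this; linarith
  have e1 : (l + 1 : ℂ) / y + (d + 1) = (z + (l + 1)) / y := by rw [hz]; field_simp; ring
  have e2 : (l + 1 : ℂ) / -y + (d + 1) = (z - (l + 1)) / y := by rw [hz]; field_simp; ring
  rw [e1, e2, ← hz]
  field_simp
  rw [hz]
  ring

theorem IsEvenDirichlet.median_identity {t : ℕ → ℂ} {β : ℂ → ℂ} (h : IsEvenDirichlet t β) {y : ℂ}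
    (hy : 0 < y.im) (h1 : Summable (laplaceTerm t y)) (h2 : Summable (laplaceTerm t (-y))) :
    ∑' p, laplaceTerm t y p - ∑' p, laplaceTerm t (-y) p
      = Real.pi * I * abelSum t + 2 * Real.pi * I * lambertSeries t y + squareSum t / y := by
  obtain ⟨M, hM⟩ := h.bdd
  obtain ⟨M', hM'⟩ := h.bdd_coeff
  set H : ℕ → ℂ := fun d => Real.pi * I * (1 / (d + 1 : ℂ)) +
    (2 * Real.pi * I * (lambertQ y d / (d + 1 : ℂ)) + 1 / y * (1 / (d + 1 : ℂ) ^ 2)) with hH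
  -- The absolutely summable part of the kernel `H`; on it Abel summation can be undone. The
  -- remaining `πi / d` is not absolutely summable and stays in Abel form, which is why `abelSum` is
  -- defined that way.
  set c : ℕ → ℂ := fun d => 2 * Real.pi * I * (lambertQ y d / (d + 1 : ℂ))
    + 1 / y * (1 / (d + 1 : ℂ) ^ 2) with hc
  set P : ℕ → ℂ := fun d => ∑ j ∈ Finset.range (d + 1), t j with hP
  have hrow : ∀ d, HasSum (fun l => laplaceTerm t y (l, d) - laplaceTerm t (-y) (l, d))
      (P d * (H d - H (d + 1))) := by
    intro d
    refine (((hasSum_laplaceTerm_kernel hy d).sub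
      (hasSum_laplaceTerm_kernel hy (d + 1))).mul_left (P d)).congr_fun fun l => ?_
    simp only [laplaceTerm, hP]
    push_cast
    rw [show (d : ℂ) + 1 + 1 = d + 2 by ring]
    ring
  have hq : Summable fun d : ℕ => ‖lambertQ y d / (d + 1 : ℂ)‖ := by
    refine Summable.of_nonneg_of_le (fun _ => norm_nonneg _) (fun d => ?_)
      (summable_norm_lambertQ hy)
    rw [norm_div, norm_succ]
    exact div_le_self (norm_nonneg _) (by simp)
  have hs : Summable fun d : ℕ => ‖1 / (d + 1 : ℂ) ^ 2‖ := by
    refine summable_inverse_square.congr fun d => ?_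
    rw [norm_div, norm_one, norm_pow, norm_succ]
  have hcs : Summable fun d => ‖c d‖ := by
    refine Summable.of_nonneg_of_le (fun _ => norm_nonneg _) (fun d => norm_add_le _ _) ?_
    simp only [norm_mul (2 * Real.pi * I : ℂ), norm_mul (1 / y)]
    exact (hq.mul_left _).add (hs.mul_left _)
  have hts : HasSum (fun d => t d * c d)
      (2 * Real.pi * I * lambertSeries t y + squareSum t / y) := by
    have e1 : Summable fun d : ℕ => t d / (d + 1 : ℂ) * lambertQ y d :=
      Summable.of_norm_bounded (hq.mul_left M') fun d => by
        rw [div_mul_eq_mul_div, mul_div_assoc, norm_mul]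
        gcongr
        exact hM' d
    have e2 : Summable fun d : ℕ => t d / (d + 1 : ℂ) ^ 2 :=
      Summable.of_norm_bounded (hs.mul_left M') fun d => by
        rw [← mul_one_div, norm_mul]
        gcongr
        exact hM' d
    refine ((e1.hasSum.mul_left (2 * Real.pi * I)).add (e2.hasSum.div_const y)).congr_fun
      fun d => ?_
    simp only [hc]
    ring
  have hA : Summable fun d => P d * (1 / (d + 1 : ℂ) - 1 / (d + 2 : ℂ)) :=
    Summable.of_norm_bounded (summable_one_div_succ_sub.mul_left M) fun d => by
      rw [norm_mul]
      gcongr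
      exact hM d
  have hcol : HasSum (fun d => P d * (H d - H (d + 1)))
      (Real.pi * I * abelSum t + (2 * Real.pi * I * lambertSeries t y + squareSum t / y)) := by
    refine ((hA.hasSum.mul_left (Real.pi * I)).add (hasSum_abel_summation hM hcs hts)).congr_fun
      fun d => ?_
    simp only [hH, hc, hP]
    push_cast
    rw [show (d : ℂ) + 1 + 1 = d + 2 by ring]
    ring
  have hsum := (h1.sub h2)
  have hswap : Summable fun p : ℕ × ℕ => laplaceTerm t y p.swap - laplaceTerm t (-y) p.swap :=
    (Equiv.prodComm ℕ ℕ).summable_iff.2 hsum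
  have hswap' : ∑' p : ℕ × ℕ, (laplaceTerm t y p.swap - laplaceTerm t (-y) p.swap)
      = ∑' p, (laplaceTerm t y p - laplaceTerm t (-y) p) := 
    (Equiv.prodComm ℕ ℕ).tsum_eq fun p => laplaceTerm t y p - laplaceTerm t (-y) p
  rw [← h1.tsum_sub h2, ← hswap', hswap.tsum_prod, add_assoc, ← hcol.tsum_eq]
  exact tsum_congr fun d => (hrow d).tsum_eq

/-! ### The resurgent series of a Lambert series -/

/-- The Laplace integral of `b` along the ray of direction `θ`. -/
noncomputable def laplace (b : ℂ → ℂ) (θ : ℝ) (y : ℂ) : ℂ :=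
  ∫ t in Set.Ioi (0 : ℝ),
    exp (-((t : ℂ) * exp ((θ : ℂ) * I)) / y) * b ((t : ℂ) * exp ((θ : ℂ) * I))
      * exp ((θ : ℂ) * I)

theorem laplace_const_mul (a : ℂ) (b : ℂ → ℂ) (θ : ℝ) (y : ℂ) :
    laplace (fun ζ => a * b ζ) θ y = a * laplace b θ y := by
  rw [laplace, laplace, ← MeasureTheory.integral_const_mul]
  congr 1
  ext t
  ring

theorem re_exp_mul (θ : ℝ) (y : ℂ) :
    (exp (-(θ : ℂ) * I) * y).re = Real.cos θ * y.re + Real.sin θ * y.im := by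
  rw [← ofReal_neg, exp_mul_I, ← ofReal_cos, ← ofReal_sin, Real.cos_neg, Real.sin_neg]
  simp [-ofReal_cos, -ofReal_sin]

theorem ne_zero_of_mem_sector {θ c : ℝ} {y : ℂ} (hy : y ∈ sector θ c) : y ≠ 0 := by
  rintro rfl
  simp [sector] at hy

theorem re_exp_div_pos {θ : ℝ} {y : ℂ} (hy : y ∈ sector θ 0) :
    0 < (exp ((θ : ℂ) * I) / y).re := by
  have h := norm_pos_iff.2 (ne_zero_of_mem_sector hy)
  rw [re_exp_div]
  simp only [sector, Set.mem_ofPred_eq, zero_mul] at hy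
  positivity

theorem IsEvenDirichlet.hasSum_laplace {t : ℕ → ℂ} {β : ℂ → ℂ} (h : IsEvenDirichlet t β)
    {θ : ℝ} (hθ : 0 < Real.cos θ) {y : ℂ} (hy : y ∈ sector θ 0) :
    HasSum (laplaceTerm t y) (laplace (inverseSquareSum β) θ y) :=
  h.hasSum_laplaceTerm hθ (re_exp_div_pos hy)

/-- The substitution `ζ ↦ -ζ` moves the ray to the right half-plane and replaces `y` by `-y`;
evenness preserves the Borel transform, and `dζ` gives the sign. -/
theorem IsEvenDirichlet.hasSum_neg_laplace {t : ℕ → ℂ} {β : ℂ → ℂ} (h : IsEvenDirichlet t β)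
    {θ : ℝ} (hθ : Real.cos θ < 0) {y : ℂ} (hy : y ∈ sector θ 0) :
    HasSum (laplaceTerm t (-y)) (-laplace (inverseSquareSum β) θ y) := by
  have he : exp (((θ + Real.pi : ℝ) : ℂ) * I) = -exp ((θ : ℂ) * I) := by
    push_cast
    rw [add_mul, exp_add, exp_pi_mul_I]; ring
  have hy' : -y ∈ sector (θ + Real.pi) 0 := by
    simp only [sector, Set.mem_ofPred_eq, zero_mul, re_exp_mul] at hy ⊢
    simpa [Real.cos_add_pi, Real.sin_add_pi] using hy
  have h1 := h.hasSum_laplace (by rw [Real.cos_add_pi]; linarith) hy'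
  convert h1 using 1
  rw [laplace, laplace, ← MeasureTheory.integral_neg]
  refine MeasureTheory.setIntegral_congr_fun measurableSet_Ioi fun x hx => ?_
  have hx : 0 < x := hx
  have h2 : inverseSquareSum β ((x : ℂ) * -exp ((θ : ℂ) * I))
      = inverseSquareSum β ((x : ℂ) * exp ((θ : ℂ) * I)) := by
    rw [mul_neg, h.inverseSquareSum_neg]
    rw [re_ofReal_mul, exp_ofReal_mul_I_re]
    exact mul_ne_zero hx.ne' hθ.ne
  simp only [he, h2]
  rw [mul_neg, neg_div_neg_eq, mul_neg]

/-- The formal series with leading coefficients `-(∑ t_{d-1} d^{-2}) / (2πi)` and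
`-s (∑ t_{d-1} / d) / 2`, whose Borel transform is `(1 / πi) ∑_{ℓ ≥ 1} ℓ^{-2} β(ζ/ℓ)`. -/
noncomputable def resurgentSeries (t : ℕ → ℂ) (β : ℂ → ℂ) (s : ℝ) : LaurentSeries ℂ :=
  HahnSeries.ofSuppBddBelow
    (fun j : ℤ => if j < -1 then 0
      else if j = -1 then -squareSum t / (2 * Real.pi * I)
      else if j = 0 then -(s * abelSum t / 2)
      else 1 / (Real.pi * I) * iteratedDeriv (j - 1).toNat (inverseSquareSum β) 0)
    ⟨-1, fun j hj => by
      by_contra hlt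
      exact hj (if_pos (not_le.1 hlt))⟩

theorem truncation_zero_resurgentSeries (t : ℕ → ℂ) (β : ℂ → ℂ) (s : ℝ) (y : ℂ) :
    truncation (resurgentSeries t β s) 0 y
      = -squareSum t / (2 * Real.pi * I) / y - s * abelSum t / 2 := by
  -- The zero series has order `0` by convention, so it satisfies the bound too.
  have h : -1 ≤ (resurgentSeries t β s).order := by
    by_contra hlt
    push Not at hlt
    have h0 : resurgentSeries t β s ≠ 0 := fun h0 => by
      rw [h0, HahnSeries.order_zero] at hlt; omega
    exact HahnSeries.coeff_order_eq_zero.not.2 h0 (if_pos hlt)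
  rw [truncation_eq_sum_Icc _ h, show Finset.Icc (-1 : ℤ) 0 = {-1, 0} by decide,
    Finset.sum_pair (by decide)]
  simp [resurgentSeries, div_eq_mul_inv, sub_eq_add_neg]

theorem coeff_resurgentSeries (t : ℕ → ℂ) (β : ℂ → ℂ) (s : ℝ) (r : ℕ) :
    (resurgentSeries t β s).coeff ((r : ℤ) + 1)
      = 1 / (Real.pi * I) * iteratedDeriv r (inverseSquareSum β) 0 := by
  simp only [resurgentSeries, HahnSeries.ofSuppBddBelow]
  rw [if_neg (by omega), if_neg (by omega), if_neg (by omega)]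
  simp

theorem IsEvenDirichlet.isBorelTransform {t : ℕ → ℂ} {β : ℂ → ℂ} (h : IsEvenDirichlet t β)
    (s : ℝ) : IsBorelTransform (resurgentSeries t β s)
      (fun ζ => 1 / (Real.pi * I) * inverseSquareSum β ζ) := by
  filter_upwards [h.inverseSquareSum_analyticAt.hasFPowerSeriesAt.eventually_hasSum] with ζ hζ
  rw [zero_add] at hζ
  refine (hζ.mul_left (1 / (Real.pi * I))).congr_fun fun r => ?_
  simp only [coeff_resurgentSeries, FormalMultilinearSeries.ofScalars_apply_eq, smul_eq_mul]
  ring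

theorem IsEvenDirichlet.ray_bound {t : ℕ → ℂ} {β : ℂ → ℂ} (h : IsEvenDirichlet t β) {θ : ℝ}
    (hθ : Real.cos θ ≠ 0) (a : ℂ) :
    (∃ B : ℝ, ∀ x : ℝ, 0 < x → ‖a * inverseSquareSum β ((x : ℂ) * exp ((θ : ℂ) * I))‖ ≤ B) ∧
      ContinuousOn (fun x : ℝ => a * inverseSquareSum β ((x : ℂ) * exp ((θ : ℂ) * I)))
        (Set.Ioi 0) := by
  obtain ⟨c, B, hc0, hc1, hd, hB⟩ := h.exists_sector hθ
  refine ⟨⟨‖a‖ * B, fun x hx => ?_⟩, ?_⟩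
  · rw [norm_mul]
    have := hB _ (sector_exp_mem (θ := θ) hc1 hx)
    gcongr
  · refine continuousOn_const.mul (hd.continuousOn.comp (by fun_prop) fun x hx => ?_)
    exact sector_exp_mem hc1 hx

theorem IsEvenDirichlet.hasBorelLaplaceSum {t : ℕ → ℂ} {β : ℂ → ℂ} (h : IsEvenDirichlet t β)
    (s : ℝ) {θ : ℝ} (hθ : Real.cos θ ≠ 0) {y : ℂ} (hy : y ∈ sector θ 0) :
    HasBorelLaplaceSum (resurgentSeries t β s) θ y (truncation (resurgentSeries t β s) 0 y
      + 1 / (Real.pi * I) * laplace (inverseSquareSum β) θ y) := by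
  obtain ⟨c, B, hc0, hc1, hd, hB⟩ := h.exists_sector hθ
  obtain ⟨⟨B', hB'⟩, hcont⟩ := h.ray_bound hθ (1 / (Real.pi * I))
  have hi := integrableOn_laplace (b := fun ζ => 1 / (Real.pi * I) * inverseSquareSum β ζ)
    (re_exp_div_pos hy) hB' hcont
  have hb : ∀ ζ ∈ sector θ c, ‖1 / (Real.pi * I) * inverseSquareSum β ζ‖
      ≤ ‖1 / (Real.pi * I : ℂ)‖ * B * Real.exp (0 * ‖ζ‖) := by
    intro ζ hζ
    rw [zero_mul, Real.exp_zero, mul_one, norm_mul]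
    have := hB ζ hζ
    gcongr
  rw [← laplace_const_mul, laplace]
  exact ⟨hy, fun ζ => 1 / (Real.pi * I) * inverseSquareSum β ζ, c, hc0, hc1,
    h.isBorelTransform s, hd.const_mul _, ⟨_, 0, hb⟩, hi, rfl⟩

/-- Turning the direction by `δ` moves the rotated point by at most `|δ| ‖y‖`, so a subsector of
margin `c` keeps margin `c - |δ|`. -/
theorem re_exp_add_mul_ge {θ c : ℝ} {y : ℂ} (hy : y ∈ sector θ c) (δ : ℝ) :
    (c - |δ|) * ‖y‖ ≤ (exp (-((θ + δ : ℝ) : ℂ) * I) * y).re := by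
  have h1 : exp (-((θ + δ : ℝ) : ℂ) * I) * y = exp (-(θ : ℂ) * I) * y
      + (exp (I * ((-δ : ℝ) : ℂ)) - 1) * (exp (-(θ : ℂ) * I) * y) := by
    have : exp (-((θ + δ : ℝ) : ℂ) * I) = exp (I * ((-δ : ℝ) : ℂ)) * exp (-(θ : ℂ) * I) := by
      rw [← exp_add]; congr 1; push_cast; ring
    rw [this]; ring
  have h2 : ‖(exp (I * ((-δ : ℝ) : ℂ)) - 1) * (exp (-(θ : ℂ) * I) * y)‖ ≤ |δ| * ‖y‖ := by
    have h3 := Real.norm_exp_I_mul_ofReal_sub_one_le (x := -δ)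
    rw [Real.norm_eq_abs, abs_neg] at h3
    rw [norm_mul, norm_mul, ← ofReal_neg, norm_exp_ofReal_mul_I, one_mul]
    gcongr
  have h3 := (abs_le.1 ((abs_re_le_norm _).trans h2)).1
  simp only [sector, Set.mem_ofPred_eq] at hy
  rw [h1, add_re]
  linarith

theorem cos_shift {σ : ℝ} (hσ : σ = 1 ∨ σ = -1) (ε : ℝ) :
    Real.cos (σ * (Real.pi / 2) + ε) = -(σ * Real.sin ε) := by
  rcases hσ with rfl | rfl
  · rw [one_mul, add_comm, Real.cos_add_pi_div_two]; ring
  · rw [add_comm, neg_one_mul, ← sub_eq_add_neg, Real.cos_sub_pi_div_two]; ring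

theorem re_exp_quarter_mul {σ : ℝ} (hσ : σ = 1 ∨ σ = -1) (y : ℂ) :
    (exp (-((σ * (Real.pi / 2) : ℝ) : ℂ) * I) * y).re = σ * y.im := by
  rw [re_exp_mul]
  rcases hσ with rfl | rfl <;> simp

/-- The average of the two lateral Laplace integrals. -/
theorem IsEvenDirichlet.laplace_add_laplace {t : ℕ → ℂ} {β : ℂ → ℂ} (h : IsEvenDirichlet t β)
    {σ : ℝ} (hσ : σ = 1 ∨ σ = -1) {ε : ℝ} (hε0 : 0 < ε) (hεπ : ε < Real.pi) {y : ℂ}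
    (h1 : y ∈ sector (σ * (Real.pi / 2) + ε) 0) (h2 : y ∈ sector (σ * (Real.pi / 2) - ε) 0) :
    Summable (laplaceTerm t y) ∧ Summable (laplaceTerm t (-y)) ∧
    laplace (inverseSquareSum β) (σ * (Real.pi / 2) + ε) y
      + laplace (inverseSquareSum β) (σ * (Real.pi / 2) - ε) y
      = ∑' p, laplaceTerm t y p - ∑' p, laplaceTerm t (-y) p := by
  have hs := Real.sin_pos_of_pos_of_lt_pi hε0 hεπ
  have c1 := cos_shift hσ ε
  have c2 := cos_shift hσ (-ε)
  rw [Real.sin_neg, ← sub_eq_add_neg] at c2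
  -- For `σ = 1` the ray at `+ε` lies in the left half-plane and the one at `-ε` in the right; for
  -- `σ = -1` they are exchanged.
  rcases hσ with rfl | rfl
  · have e1 := h.hasSum_neg_laplace (by rw [c1]; linarith) h1
    have e2 := h.hasSum_laplace (by rw [c2]; linarith) h2
    refine ⟨e2.summable, e1.summable, ?_⟩
    rw [e1.tsum_eq, e2.tsum_eq]; ring
  · have e1 := h.hasSum_laplace (by rw [c1]; linarith) h1
    have e2 := h.hasSum_neg_laplace (by rw [c2]; linarith) h2
    refine ⟨e1.summable, e2.summable, ?_⟩
    rw [e1.tsum_eq, e2.tsum_eq]; ring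

theorem eventually_mem_sector {σ : ℝ} (hσ : σ = 1 ∨ σ = -1) {y : ℂ} (hy : 0 < σ * y.im) :
    ∀ᶠ ε : ℝ in 𝓝[>] 0, 0 < ε ∧ ε < Real.pi ∧ y ∈ sector (σ * (Real.pi / 2) + ε) 0 ∧
      y ∈ sector (σ * (Real.pi / 2) - ε) 0 := by
  have hcont : Continuous fun ε : ℝ => (exp (-((σ * (Real.pi / 2) + ε : ℝ) : ℂ) * I) * y).re :=
    continuous_re.comp (by fun_prop)
  have hcont' : Continuous fun ε : ℝ => (exp (-((σ * (Real.pi / 2) - ε : ℝ) : ℂ) * I) * y).re :=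
    continuous_re.comp (by fun_prop)
  have h1 := hcont.tendsto 0
  have h2 := hcont'.tendsto 0
  rw [add_zero, re_exp_quarter_mul hσ] at h1
  rw [sub_zero, re_exp_quarter_mul hσ] at h2
  have h3 : ∀ᶠ ε : ℝ in 𝓝[>] 0, ε < Real.pi :=
    nhdsWithin_le_nhds (gt_mem_nhds Real.pi_pos)
  filter_upwards [self_mem_nhdsWithin, h3, nhdsWithin_le_nhds (h1.eventually_const_lt hy),
    nhdsWithin_le_nhds (h2.eventually_const_lt hy)] with ε a b c d
  refine ⟨a, b, ?_, ?_⟩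
  · simpa [sector] using c
  · simpa [sector] using d

/-- A function which is, on the half-plane `σ Im y > 0`, the half-sum of the Laplace integrals of
`(1 / πi) ∑_{ℓ ≥ 1} ℓ^{-2} β(ζ/ℓ)`, up to its polar and constant terms, is asymptotic to
`resurgentSeries` and is reconstructed from it by median resummation. -/
theorem IsEvenDirichlet.resurgence {t : ℕ → ℂ} {β : ℂ → ℂ} (h : IsEvenDirichlet t β) {f : ℂ → ℂ}
    {σ : ℝ} (hσ : σ = 1 ∨ σ = -1)
    (hf : ∀ y : ℂ, 0 < σ * y.im → Summable (laplaceTerm t y) → Summable (laplaceTerm t (-y)) →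
      f y = -squareSum t / (2 * Real.pi * I) / y - σ * abelSum t / 2
        + 1 / (Real.pi * I) * ((∑' p, laplaceTerm t y p - ∑' p, laplaceTerm t (-y) p) / 2)) :
    IsAsymptoticExpansion f (σ * (Real.pi / 2)) (resurgentSeries t β σ) ∧
      IsGevreyOne (resurgentSeries t β σ) ∧
      ∀ y : ℂ, 0 < σ * y.im →
        HasMedianSum (resurgentSeries t β σ) (σ * (Real.pi / 2)) y (f y) := by
  set φ := resurgentSeries t β σ with hφ
  have hB := h.isBorelTransform σ
  have hcos : ∀ ε : ℝ, 0 < ε → ε < Real.pi → Real.cos (σ * (Real.pi / 2) + ε) ≠ 0 ∧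
      Real.cos (σ * (Real.pi / 2) - ε) ≠ 0 := by
    intro ε h0 h1
    have hs := Real.sin_pos_of_pos_of_lt_pi h0 h1
    rw [sub_eq_add_neg, cos_shift hσ, cos_shift hσ, Real.sin_neg]
    rcases hσ with rfl | rfl <;> simp [hs.ne']
  have hval : ∀ (y : ℂ) (ε : ℝ), 0 < σ * y.im → 0 < ε → ε < Real.pi →
      y ∈ sector (σ * (Real.pi / 2) + ε) 0 → y ∈ sector (σ * (Real.pi / 2) - ε) 0 →
      f y = truncation φ 0 y + 1 / (Real.pi * I) *
        ((laplace (inverseSquareSum β) (σ * (Real.pi / 2) + ε) y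
          + laplace (inverseSquareSum β) (σ * (Real.pi / 2) - ε) y) / 2) := by
    intro y ε hy h0 h1 h2 h3
    obtain ⟨s1, s2, e⟩ := h.laplace_add_laplace hσ h0 h1 h2 h3
    rw [hf y hy s1 s2, e, hφ, truncation_zero_resurgentSeries]
  refine ⟨isAsymptoticExpansion_of_nat fun c hc0 hc1 R => ?_, hB.isGevreyOne, fun y hy => ?_⟩
  -- The half-sum does not depend on `ε`, so one value suffices for the whole subsector; `c / 2`
  -- leaves both lateral rays the margin `c - ε = ε`.
  · set ε : ℝ := c / 2 with hε
    have hε0 : 0 < ε := by positivity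
    have hεπ : ε < Real.pi := by have := Real.pi_gt_three; linarith
    obtain ⟨⟨B₁, hB₁⟩, hc₁⟩ := h.ray_bound (hcos ε hε0 hεπ).1 (1 / (Real.pi * I))
    obtain ⟨⟨B₂, hB₂⟩, hc₂⟩ := h.ray_bound (hcos ε hε0 hεπ).2 (1 / (Real.pi * I))
    obtain ⟨C₁, hC₁⟩ := hB.watson hB₁ hc₁ R hε0
    obtain ⟨C₂, hC₂⟩ := hB.watson hB₂ hc₂ R hε0
    refine IsBigO.of_bound ((C₁ + C₂) / 2) ?_
    filter_upwards [self_mem_nhdsWithin] with y hy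
    have hy0 : y ≠ 0 := ne_zero_of_mem_sector hy
    have hyn : 0 < ‖y‖ := norm_pos_iff.2 hy0
    have hyσ : 0 < σ * y.im := by
      have h1 : c * ‖y‖ < (exp (-((σ * (Real.pi / 2) : ℝ) : ℂ) * I) * y).re := hy
      rw [re_exp_quarter_mul hσ] at h1
      exact lt_of_le_of_lt (by positivity) h1
    have k1 := re_exp_add_mul_ge hy ε
    have k2 := re_exp_add_mul_ge hy (-ε)
    rw [abs_of_pos hε0, show c - ε = ε by rw [hε]; ring] at k1
    rw [abs_neg, abs_of_pos hε0, show c - ε = ε by rw [hε]; ring, ← sub_eq_add_neg] at k2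
    have w1 := hC₁ y hy0 k1
    have w2 := hC₂ y hy0 k2
    have hpos : 0 < ε * ‖y‖ := by positivity
    have m1 : y ∈ sector (σ * (Real.pi / 2) + ε) 0 := by
      simp only [sector, Set.mem_ofPred_eq, zero_mul]; exact hpos.trans_le k1
    have m2 : y ∈ sector (σ * (Real.pi / 2) - ε) 0 := by
      simp only [sector, Set.mem_ofPred_eq, zero_mul]; exact hpos.trans_le k2
    change ‖laplace (fun ζ => 1 / (Real.pi * I) * inverseSquareSum β ζ) _ y - _‖ ≤ _ at w1
    change ‖laplace (fun ζ => 1 / (Real.pi * I) * inverseSquareSum β ζ) _ y - _‖ ≤ _ at w2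
    rw [laplace_const_mul] at w1 w2
    rw [hval y ε hyσ hε0 hεπ m1 m2, truncation_natCast]
    set S := ∑ r ∈ Finset.range R, φ.coeff ((r : ℤ) + 1) * y ^ (r + 1)
    set L₁ := laplace (inverseSquareSum β) (σ * (Real.pi / 2) + ε) y
    set L₂ := laplace (inverseSquareSum β) (σ * (Real.pi / 2) - ε) y
    have e1 : truncation φ 0 y + 1 / (Real.pi * I) * ((L₁ + L₂) / 2) - (truncation φ 0 y + S)
        = ((1 / (Real.pi * I) * L₁ - S) + (1 / (Real.pi * I) * L₂ - S)) / 2 := by ring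
    have e2 : ‖‖y‖ ^ ((R : ℤ) + 1)‖ = ‖y‖ ^ (R + 1) := by
      rw [norm_zpow, norm_norm]; norm_cast
    rw [e1, e2, norm_div, RCLike.norm_ofNat]
    have e3 := norm_add_le (1 / (Real.pi * I) * L₁ - S) (1 / (Real.pi * I) * L₂ - S)
    linarith
  · filter_upwards [eventually_mem_sector hσ hy] with ε ⟨h0, h1, h2, h3⟩
    refine ⟨_, _, h.hasBorelLaplaceSum σ (hcos ε h0 h1).1 h2,
      h.hasBorelLaplaceSum σ (hcos ε h0 h1).2 h3, ?_⟩
    rw [hval y ε hy h0 h1 h2 h3]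
    ring

/-! ### Double series over divisors -/

/-- Pairs of positive integers are regrouped by their product, through `sigmaAntidiagonalEquivProd`.
-/
theorem hasSum_divisors {E : Type*} [NormedAddCommGroup E] {F : ℕ → ℕ → E} (hF : Summable fun p : ℕ × ℕ => F (p.1 + 1) (p.2 + 1)) :
    HasSum (fun n : ℕ => ∑ d ∈ (n + 1).divisors, F d ((n + 1) / d))
      (∑' p : ℕ × ℕ, F (p.1 + 1) (p.2 + 1)) := by
  have h1 : HasSum (fun p : ℕ+ × ℕ+ => F p.1 p.2) (∑' p : ℕ × ℕ, F (p.1 + 1) (p.2 + 1)) := by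
    rw [← (Equiv.pnatEquivNat.symm.prodCongr Equiv.pnatEquivNat.symm).hasSum_iff]
    exact hF.hasSum
  rw [← sigmaAntidiagonalEquivProd.hasSum_iff] at h1
  have h2 := h1.sigma fun n => hasSum_fintype _
  rw [← Equiv.pnatEquivNat.symm.hasSum_iff] at h2
  refine h2.congr_fun fun n => ?_
  rw [← Nat.sum_divisorsAntidiagonal fun x y => F x y,
    ← Finset.sum_coe_sort (n + 1).divisorsAntidiagonal]
  rfl

theorem tsum_divisors_mul_pow {a : ℕ → ℂ} {M : ℝ} (ha : ∀ d, ‖a d‖ ≤ M) {q : ℂ} (hq : ‖q‖ < 1) :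
    ∑' n : ℕ, (∑ d ∈ (n + 1).divisors, a d) * q ^ (n + 1)
      = ∑' d : ℕ, a (d + 1) * (q ^ (d + 1) / (1 - q ^ (d + 1))) := by
  have hM0 : 0 ≤ M := (norm_nonneg _).trans (ha 0)
  have hs : Summable fun p : ℕ × ℕ => a (p.1 + 1) * q ^ ((p.1 + 1) * (p.2 + 1)) := by
    have hg := summable_geometric_of_lt_one (norm_nonneg q) hq
    refine Summable.of_norm_bounded ((hg.mul_of_nonneg hg (fun _ => by positivity)
      fun _ => by positivity).mul_left M) fun p => ?_
    rw [norm_mul, norm_pow, ← pow_add]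
    have h1 : ‖q‖ ^ ((p.1 + 1) * (p.2 + 1)) ≤ ‖q‖ ^ (p.1 + p.2) :=
      pow_le_pow_of_le_one (norm_nonneg _) hq.le (by nlinarith)
    gcongr
    exact ha _
  have h1 := hasSum_divisors (F := fun d l => a d * q ^ (d * l)) hs
  have h2 : ∀ n : ℕ, ∑ d ∈ (n + 1).divisors, a d * q ^ (d * ((n + 1) / d))
      = (∑ d ∈ (n + 1).divisors, a d) * q ^ (n + 1) := by
    intro n
    rw [Finset.sum_mul]
    exact Finset.sum_congr rfl fun d hd => by rw [Nat.mul_div_cancel' (Nat.dvd_of_mem_divisors hd)]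
  simp only [h2] at h1
  rw [h1.tsum_eq, hs.tsum_prod]
  refine tsum_congr fun d => ?_
  have hq' : ‖q ^ (d + 1)‖ < 1 := by
    rw [norm_pow]; exact pow_lt_one₀ (norm_nonneg _) hq (by omega)
  have h3 := (hasSum_geometric_of_norm_lt_one hq').mul_left (a (d + 1) * q ^ (d + 1))
  rw [mul_assoc, ← div_eq_mul_inv] at h3
  rw [← h3.tsum_eq]
  exact tsum_congr fun l => by rw [pow_mul]; ring

/-! ### The Dirichlet series attached to a root of unity -/

theorem norm_sum_pow_succ_le {w : ℂ} (hw : ‖w‖ = 1) (hw1 : w ≠ 1) (d : ℕ) :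
    ‖∑ j ∈ Finset.range (d + 1), w ^ (j + 1)‖ ≤ 2 / ‖w - 1‖ := by
  simp only [pow_succ']
  rw [← Finset.mul_sum, geom_sum_eq hw1, norm_mul, hw, one_mul, norm_div]
  gcongr
  refine (norm_sub_le _ _).trans ?_
  rw [norm_pow, hw]
  norm_num

/-- Source of the evenness of `β`: at `z = w^{±1} e^{-η}` it relates each fraction at `η` to the
other at `-η`, and the two constants `1` cancel in the difference. -/
theorem one_div_one_sub_add {z : ℂ} (hz0 : z ≠ 0) (hz : 1 - z ≠ 0) :
    1 / (1 - z) + 1 / (1 - z⁻¹) = 1 := by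
  have h1 : 1 - z⁻¹ = -(1 - z) / z := by field_simp; ring
  rw [h1]
  field_simp
  ring

/-- `‖w‖ = 1` confines the poles to the imaginary axis; `w ≠ 1` keeps `0` from being a pole and
bounds the partial sums of the powers. -/
theorem isEvenDirichlet_of_norm_eq_one {w : ℂ} (hw : ‖w‖ = 1) (hw1 : w ≠ 1) :
    IsEvenDirichlet (fun d => w ^ (d + 1) - w⁻¹ ^ (d + 1))
      (fun η => 1 / (1 - w * exp (-η)) - 1 / (1 - w⁻¹ * exp (-η))) := by
  have hw0 : w ≠ 0 := by rintro rfl; simp at hw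
  have hv : ‖w⁻¹‖ = 1 := by rw [norm_inv, hw, inv_one]
  have hv1 : w⁻¹ ≠ 1 := by simpa using hw1
  have hne : ∀ {u : ℂ}, ‖u‖ = 1 → ∀ {η : ℂ}, η.re ≠ 0 → 1 - u * exp (-η) ≠ 0 := by
    intro u hu η hη h0
    have h1 : ‖u * exp (-η)‖ = 1 := by rw [← sub_eq_zero.1 h0, norm_one]
    rw [norm_mul, hu, one_mul, norm_exp, Real.exp_eq_one_iff, neg_re, neg_eq_zero] at h1
    exact hη h1
  refine ⟨⟨2 / ‖w - 1‖ + 2 / ‖w⁻¹ - 1‖, fun d => ?_⟩, ?_, fun η hη => ?_, fun η hη => ?_,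
    fun η hη => ?_⟩
  · rw [Finset.sum_sub_distrib]
    exact (norm_sub_le _ _).trans
      (add_le_add (norm_sum_pow_succ_le hw hw1 d) (norm_sum_pow_succ_le hv hv1 d))
  · have h1 : ∀ u : ℂ, u ≠ 1 → AnalyticAt ℂ (fun η => 1 / (1 - u * exp (-η))) 0 := by
      intro u hu
      refine analyticAt_const.div (by fun_prop) ?_
      simpa [sub_eq_zero] using hu.symm
    exact (h1 w hw1).sub (h1 _ hv1)
  · have h1 : ∀ u : ℂ, ‖u‖ = 1 → DifferentiableAt ℂ (fun η => 1 / (1 - u * exp (-η))) η := by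
      intro u hu
      exact (differentiableAt_const _).div (by fun_prop) (hne hu hη)
    exact ((h1 w hw).sub (h1 _ hv)).differentiableWithinAt
  · have a1 := one_div_one_sub_add (mul_ne_zero hw0 (exp_ne_zero _)) (hne hw hη)
    have a2 := one_div_one_sub_add (mul_ne_zero (inv_ne_zero hw0) (exp_ne_zero _)) (hne hv hη)
    rw [mul_inv, ← exp_neg] at a1 a2
    rw [inv_inv] at a2
    linear_combination a2 - a1
  · have h1 : ∀ u : ℂ, ‖u‖ = 1 → HasSum (fun d : ℕ => u ^ (d + 1) * exp (-((d + 1 : ℂ) * η)))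
        (1 / (1 - u * exp (-η)) - 1) := by
      intro u hu
      have hz : ‖u * exp (-η)‖ < 1 := by
        rw [norm_mul, hu, one_mul, norm_exp, Real.exp_lt_one_iff]
        simpa using hη
      have h2 : HasSum (fun d : ℕ => (u * exp (-η)) ^ (d + 1)) ((1 - u * exp (-η))⁻¹ - 1) := by
        have h3 := hasSum_geometric_of_norm_lt_one hz
        rw [← hasSum_nat_add_iff' 1] at h3
        simpa only [Finset.sum_range_one, pow_zero] using h3
      rw [← one_div] at h2
      refine h2.congr_fun fun d => ?_
      rw [mul_pow, ← exp_nat_mul]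
      congr 2
      push_cast
      ring
    have h2 := (h1 w hw).sub (h1 _ hv)
    rw [sub_sub_sub_cancel_right] at h2
    exact h2.congr_fun fun d => by ring

/-! ### The generating function of the Stokes constants -/

/-- The root of unity `e^{2πik/N}`. -/
noncomputable def zetaPow (N k : ℕ) : ℂ := exp ((2 * Real.pi * k / N : ℝ) * I)

theorem norm_zetaPow (N k : ℕ) : ‖zetaPow N k‖ = 1 := norm_exp_ofReal_mul_I _

theorem zetaPow_ne_one {N k : ℕ} (hk : 0 < k) (hkN : k < N) : zetaPow N k ≠ 1 := by
  have hN : (0 : ℝ) < N := by exact_mod_cast hk.trans hkN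
  intro h
  obtain ⟨j, hj⟩ := exp_eq_one_iff.1 h
  have h1 : ((2 * Real.pi * k / N : ℝ) : ℂ) = ((j * (2 * Real.pi) : ℝ) : ℂ) := by
    refine mul_right_cancel₀ I_ne_zero ?_
    rw [hj]; push_cast; ring
  have h2 : 2 * Real.pi * k / N = j * (2 * Real.pi) := by exact_mod_cast h1
  have h3 : (k : ℝ) = j * N := by
    have := Real.pi_pos
    field_simp at h2
    linarith
  have h4 : (k : ℤ) = j * N := by exact_mod_cast h3
  have h5 : (0 : ℤ) < k := by exact_mod_cast hk
  have h6 : (k : ℤ) < N := by exact_mod_cast hkN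
  have h7 : 0 < j := by
    by_contra h0
    push Not at h0
    nlinarith
  nlinarith

theorem zetaPow_pow_sub (N k d : ℕ) :
    zetaPow N k ^ d - (zetaPow N k)⁻¹ ^ d
      = 2 * I * (Real.sin (2 * Real.pi * k * d / N) : ℂ) := by
  rw [zetaPow, ← exp_neg, ← exp_nat_mul, ← exp_nat_mul, ofReal_sin, Complex.sin]
  have e1 : (d : ℂ) * (((2 * Real.pi * k / N : ℝ) : ℂ) * I)
      = ((2 * Real.pi * k * d / N : ℝ) : ℂ) * I := by push_cast; ring
  have e2 : (d : ℂ) * -(((2 * Real.pi * k / N : ℝ) : ℂ) * I)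
      = -((2 * Real.pi * k * d / N : ℝ) : ℂ) * I := by push_cast; ring
  rw [e1, e2]
  linear_combination (exp (((2 * Real.pi * k * d / N : ℝ) : ℂ) * I)
    - exp (-((2 * Real.pi * k * d / N : ℝ) : ℂ) * I)) * I_mul_I

/-- The coefficients `2i (sin(2πd/N) + sin(2πmd/N) + sin(2πnd/N))`. -/
noncomputable def sineCoeff (m n d : ℕ) : ℂ :=
  2 * I * ((Real.sin (2 * Real.pi * (1 : ℕ) * d / (1 + m + n : ℕ))
    + Real.sin (2 * Real.pi * m * d / (1 + m + n : ℕ))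
    + Real.sin (2 * Real.pi * n * d / (1 + m + n : ℕ)) : ℝ) : ℂ)

theorem exists_isEvenDirichlet_sineCoeff {m n : ℕ} (hm : 0 < m) (hn : 0 < n) :
    ∃ β : ℂ → ℂ, IsEvenDirichlet (fun d => sineCoeff m n (d + 1)) β := by
  have key := fun k (h0 : 0 < k) (h1 : k < 1 + m + n) =>
    isEvenDirichlet_of_norm_eq_one (norm_zetaPow (1 + m + n) k) (zetaPow_ne_one h0 h1)
  have h := ((key 1 (by omega) (by omega)).add (key m hm (by omega))).add (key n hn (by omega))
  simp only [zetaPow_pow_sub] at h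
  refine ⟨_, (congrArg (fun t => IsEvenDirichlet t _) (funext fun d => ?_)).mp h⟩
  simp only [Pi.add_apply, sineCoeff]
  push_cast
  ring

theorem stokesS_eq_sum (m n : ℕ) (l : ℤ) :
    stokesS m n l = ∑ d ∈ l.natAbs.divisors, sineCoeff m n d / d := by
  simp only [stokesS, sineDivisorSum, ← Finset.sum_add_distrib]
  rw [ofReal_sum, Finset.mul_sum]
  refine Finset.sum_congr rfl fun d _ => ?_
  rw [sineCoeff]
  push_cast
  ring

theorem norm_sineCoeff_le (m n d : ℕ) : ‖sineCoeff m n d‖ ≤ 6 := by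
  have h1 : ∀ x y z : ℝ, ‖((Real.sin x + Real.sin y + Real.sin z : ℝ) : ℂ)‖ ≤ 3 := by
    intro x y z
    rw [norm_real, Real.norm_eq_abs]
    have a := abs_le.1 (Real.abs_sin_le_one x)
    have b := abs_le.1 (Real.abs_sin_le_one y)
    have c := abs_le.1 (Real.abs_sin_le_one z)
    exact abs_le.2 ⟨by linarith, by linarith⟩
  rw [sineCoeff, norm_mul, norm_mul, norm_I, RCLike.norm_ofNat]
  linarith [h1 (2 * Real.pi * (1 : ℕ) * d / (1 + m + n : ℕ))
    (2 * Real.pi * m * d / (1 + m + n : ℕ)) (2 * Real.pi * n * d / (1 + m + n : ℕ))]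

theorem norm_sineCoeff_div_le (m n d : ℕ) : ‖sineCoeff m n d / d‖ ≤ 6 := by
  rcases d with _ | d
  · simp
  · rw [norm_div, norm_natCast]
    refine (div_le_self (norm_nonneg _) ?_).trans (norm_sineCoeff_le m n _)
    simp

theorem tsum_stokesS {m n : ℕ} {y : ℂ} (hy : 0 < y.im) {s : ℤ} (hs : s = 1 ∨ s = -1) :
    ∑' l : ℕ, stokesS m n (s * ((l : ℤ) + 1)) * exp (2 * Real.pi * I * ((l : ℂ) + 1) * y)
      = lambertSeries (fun d => sineCoeff m n (d + 1)) y := by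
  set q : ℂ := exp (2 * Real.pi * I * y) with hq
  have hqn : ‖q‖ < 1 := by
    have h1 := norm_exp_two_pi_I_succ_mul y 0
    have h2 := exp_neg_two_pi_mul_lt_one hy
    simp only [Nat.cast_zero, zero_add, one_mul, pow_one] at h1
    rw [hq, h1]; exact h2
  have hqp : ∀ l : ℕ, q ^ (l + 1) = exp (2 * Real.pi * I * ((l + 1 : ℂ) * y)) := by
    intro l
    rw [hq, ← exp_nat_mul]
    congr 1
    push_cast
    ring
  have h1 := tsum_divisors_mul_pow (norm_sineCoeff_div_le m n) hqn
  simp only [hqp] at h1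
  rw [lambertSeries]
  simp only [lambertQ]
  push_cast at h1
  rw [← h1]
  refine tsum_congr fun l => ?_
  have h2 : (s * ((l : ℤ) + 1)).natAbs = l + 1 := by
    rcases hs with rfl | rfl <;> simp <;> omega
  rw [stokesS_eq_sum, h2, mul_assoc (2 * Real.pi * I : ℂ)]

theorem f0_of_im_pos {m n : ℕ} {y : ℂ} (hy : 0 < y.im) :
    f0 m n y = lambertSeries (fun d => sineCoeff m n (d + 1)) y := by
  rw [f0, if_pos hy, ← tsum_stokesS hy (Or.inl rfl)]
  simp only [one_mul]

theorem f0_of_im_neg {m n : ℕ} {y : ℂ} (hy : y.im < 0) :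
    f0 m n y = -lambertSeries (fun d => sineCoeff m n (d + 1)) (-y) := by
  have hy' : 0 < (-y).im := by simpa using hy
  rw [f0, if_neg (by linarith), if_pos hy, ← tsum_stokesS hy' (Or.inr rfl)]
  congr 1
  refine tsum_congr fun l => ?_
  rw [neg_one_mul]
  congr 2
  ring

theorem exists_resurgence {m n : ℕ} (hm : 0 < m) (hn : 0 < n) {σ : ℝ} (hσ : σ = 1 ∨ σ = -1) :
    ∃ φ : LaurentSeries ℂ, IsAsymptoticExpansion (f0 m n) (σ * (Real.pi / 2)) φ ∧
      IsGevreyOne φ ∧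
      ∀ y : ℂ, 0 < σ * y.im → HasMedianSum φ (σ * (Real.pi / 2)) y (f0 m n y) := by
  obtain ⟨β, h⟩ := exists_isEvenDirichlet_sineCoeff hm hn
  refine ⟨_, h.resurgence hσ fun y hy s1 s2 => ?_⟩
  have hπ : (Real.pi : ℂ) ≠ 0 := by exact_mod_cast Real.pi_ne_zero
  have hI := I_ne_zero
  have hy0 : y ≠ 0 := by rintro rfl; simp at hy
  rcases hσ with rfl | rfl
  · rw [one_mul] at hy
    rw [h.median_identity hy s1 s2, f0_of_im_pos hy]
    push_cast
    field_simp
    ring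
  · have hy' : y.im < 0 := by linarith
    -- The identity at `-y` exchanges the two double series, matching the sign in `f0_of_im_neg`.
    have hid := h.median_identity (y := -y) (by simpa using hy') s2 (by rwa [neg_neg])
    rw [neg_neg] at hid
    rw [← neg_sub (∑' p, laplaceTerm (fun d => sineCoeff m n (d + 1)) (-y) p), hid, f0_of_im_neg hy']
    push_cast
    field_simp
    ring

/-! ### Sums of simple poles -/

/-- The sum `∑_{n ≥ 1} S_{n-1} ζ / ((nρ)² - ζ²)`, with simple poles at the points `±nρ`. -/
noncomputable def poleSum (S : ℕ → ℂ) (ρ ζ : ℂ) : ℂ :=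
  ∑' n : ℕ, S n * (ζ / (((n + 1 : ℂ) * ρ) ^ 2 - ζ ^ 2))

theorem norm_poleSum_term_le {S : ℕ → ℂ} {ρ : ℂ} (hρ : ρ ≠ 0) {R : ℝ} {n : ℕ}
    (hn : 2 * R ≤ ((n : ℝ) + 1) * ‖ρ‖) {ζ : ℂ} (hζ : ‖ζ‖ ≤ R) :
    ‖S n * (ζ / (((n + 1 : ℂ) * ρ) ^ 2 - ζ ^ 2))‖
      ≤ 2 * R / ‖ρ‖ ^ 2 * (‖S n‖ / ((n : ℝ) + 1) ^ 2) := by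
  have hρ0 : 0 < ‖ρ‖ := norm_pos_iff.2 hρ
  have hR : 0 ≤ R := (norm_nonneg _).trans hζ
  have h1 : (((n : ℝ) + 1) * ‖ρ‖) ^ 2 / 2 ≤ ‖((n + 1 : ℂ) * ρ) ^ 2 - ζ ^ 2‖ := by
    have h2 := norm_sub_norm_le (((n + 1 : ℂ) * ρ) ^ 2) (ζ ^ 2)
    rw [norm_pow, norm_mul, norm_succ, norm_pow] at h2
    have h3 : ‖ζ‖ ^ 2 ≤ R ^ 2 := pow_le_pow_left₀ (norm_nonneg _) hζ 2
    have h4 : (2 * R) ^ 2 ≤ (((n : ℝ) + 1) * ‖ρ‖) ^ 2 := pow_le_pow_left₀ (by positivity) hn 2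
    nlinarith
  rw [norm_mul, norm_div]
  calc ‖S n‖ * (‖ζ‖ / ‖((n + 1 : ℂ) * ρ) ^ 2 - ζ ^ 2‖)
      ≤ ‖S n‖ * (R / ((((n : ℝ) + 1) * ‖ρ‖) ^ 2 / 2)) := by gcongr
    _ = _ := by field_simp

theorem exists_nat_two_mul_le {ρ : ℂ} (hρ : ρ ≠ 0) (R : ℝ) :
    ∃ K : ℕ, ∀ n : ℕ, 2 * R ≤ (((n + K : ℕ) : ℝ) + 1) * ‖ρ‖ := by
  have hρ0 : 0 < ‖ρ‖ := norm_pos_iff.2 hρ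
  obtain ⟨K, hK⟩ := exists_nat_ge (2 * R / ‖ρ‖)
  refine ⟨K, fun n => ?_⟩
  rw [div_le_iff₀ hρ0] at hK
  refine hK.trans ?_
  gcongr
  push_cast
  linarith [(n.cast_nonneg : (0 : ℝ) ≤ n)]

theorem summable_poleSum {S : ℕ → ℂ} (hS : Summable fun n : ℕ => ‖S n‖ / ((n : ℝ) + 1) ^ 2)
    {ρ : ℂ} (hρ : ρ ≠ 0) (ζ : ℂ) :
    Summable fun n : ℕ => S n * (ζ / (((n + 1 : ℂ) * ρ) ^ 2 - ζ ^ 2)) := by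
  obtain ⟨K, hK⟩ := exists_nat_two_mul_le hρ ‖ζ‖
  rw [← summable_nat_add_iff K]
  exact Summable.of_norm_bounded (((summable_nat_add_iff K).2 hS).mul_left _)
    fun n => norm_poleSum_term_le hρ (hK n) le_rfl

/-- Near `ζ₀` all but finitely many terms are dominated by a multiple of `‖S n‖ / (n + 1)²`. The
alternative `S n = 0` covers the series with one polar term erased. -/
theorem poleSum_analyticAt {S : ℕ → ℂ} (hS : Summable fun n : ℕ => ‖S n‖ / ((n : ℝ) + 1) ^ 2)
    {ρ : ℂ} (hρ : ρ ≠ 0) {ζ₀ : ℂ} (h0 : ∀ n : ℕ, S n = 0 ∨ ((n + 1 : ℂ) * ρ) ^ 2 ≠ ζ₀ ^ 2) :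
    AnalyticAt ℂ (poleSum S ρ) ζ₀ := by
  set R : ℝ := ‖ζ₀‖ + 1 with hR
  obtain ⟨K, hK⟩ := exists_nat_two_mul_le hρ R
  have hne : ∀ n : ℕ, ∀ ζ ∈ Metric.ball (0 : ℂ) R,
      (((n + K : ℕ) + 1 : ℂ) * ρ) ^ 2 - ζ ^ 2 ≠ 0 := by
    intro n ζ hζ h1
    rw [mem_ball_zero_iff] at hζ
    have h2 : ‖((n + K : ℕ) + 1 : ℂ) * ρ‖ = ‖ζ‖ := by
      rcases sq_eq_sq_iff_eq_or_eq_neg.1 (sub_eq_zero.1 h1) with h | h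
      · rw [h]
      · rw [h, norm_neg]
    rw [norm_mul, norm_succ] at h2
    have h3 := hK n
    have h4 : 0 < R := by positivity
    linarith
  have htail : DifferentiableOn ℂ (fun ζ => ∑' n : ℕ, S (n + K) *
      (ζ / ((((n + K : ℕ) + 1 : ℂ) * ρ) ^ 2 - ζ ^ 2))) (Metric.ball 0 R) := by
    refine differentiableOn_tsum_of_summable_norm
      (((summable_nat_add_iff K).2 hS).mul_left (2 * R / ‖ρ‖ ^ 2)) (fun n ζ hζ => ?_)
      Metric.isOpen_ball fun n ζ hζ => norm_poleSum_term_le hρ (hK n) ?_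
    · refine DifferentiableAt.differentiableWithinAt ?_
      exact (differentiableAt_const _).mul (differentiableAt_id.div (by fun_prop) (hne n ζ hζ))
    · exact (mem_ball_zero_iff.1 hζ).le
  have hζ₀ : Metric.ball (0 : ℂ) R ∈ 𝓝 ζ₀ :=
    Metric.isOpen_ball.mem_nhds (by rw [mem_ball_zero_iff]; linarith)
  have hfin : AnalyticAt ℂ (fun ζ => ∑ n ∈ Finset.range K,
      S n * (ζ / (((n + 1 : ℂ) * ρ) ^ 2 - ζ ^ 2))) ζ₀ := by
    refine Finset.analyticAt_fun_sum _ fun n _ => ?_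
    rcases h0 n with h | h
    · simp only [h, zero_mul]
      exact analyticAt_const
    · exact analyticAt_const.mul (analyticAt_id.div (by fun_prop) (sub_ne_zero.2 h))
  refine (hfin.add (htail.analyticAt hζ₀)).congr (Eventually.of_forall fun ζ => ?_)
  exact (summable_poleSum hS hρ ζ).sum_add_tsum_nat_add K

theorem poleSum_eq_add {S : ℕ → ℂ} (hS : Summable fun n : ℕ => ‖S n‖ / ((n : ℝ) + 1) ^ 2)
    {ρ : ℂ} (hρ : ρ ≠ 0) (k : ℕ) (ζ : ℂ) :
    poleSum S ρ ζ = S k * (ζ / (((k + 1 : ℂ) * ρ) ^ 2 - ζ ^ 2))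
      + poleSum (Function.update S k 0) ρ ζ := by
  rw [poleSum, (summable_poleSum hS hρ ζ).tsum_eq_add_tsum_ite k]
  congr 1
  refine tsum_congr fun n => ?_
  by_cases h : n = k
  · simp [h]
  · simp [h]

/-- Only the term of index `k` is singular at `ξ`, and `ζ / (ξ² - ζ²) = -(1/2) (1/(ζ - ξ) + 1/(ζ +
ξ))`. Fixing only `ξ²` treats both poles `±(k + 1)ρ` at once. -/
theorem exists_pole_of_poleSum {S : ℕ → ℂ}
    (hS : Summable fun n : ℕ => ‖S n‖ / ((n : ℝ) + 1) ^ 2) {ρ : ℂ} (hρ : ρ ≠ 0) (k : ℕ) {ξ : ℂ}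
    (hξ : ξ ^ 2 = ((k + 1 : ℂ) * ρ) ^ 2) :
    ∃ h : ℂ → ℂ, AnalyticAt ℂ h ξ ∧
      ∀ᶠ ζ in 𝓝[≠] ξ, poleSum S ρ ζ = -S k / (2 * (ζ - ξ)) + h ζ := by
  have hξ0 : ξ ≠ 0 := by
    rintro rfl
    rw [zero_pow two_ne_zero] at hξ
    exact pow_ne_zero 2 (mul_ne_zero (Nat.cast_add_one_ne_zero k) hρ) hξ.symm
  have hS' : Summable fun n : ℕ => ‖Function.update S k 0 n‖ / ((n : ℝ) + 1) ^ 2 := by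
    refine Summable.of_nonneg_of_le (fun _ => by positivity) (fun n => ?_) hS
    by_cases h : n = k
    · rw [h, Function.update_self, norm_zero, zero_div]; positivity
    · rw [Function.update_of_ne h]
  have h1 : AnalyticAt ℂ (poleSum (Function.update S k 0) ρ) ξ := by
    refine poleSum_analyticAt hS' hρ fun n => ?_
    by_cases h : n = k
    · left; rw [h, Function.update_self]
    · right
      rw [hξ, mul_pow, mul_pow]
      intro h2
      have h3 := mul_right_cancel₀ (pow_ne_zero 2 hρ) h2
      have h4 : (n + 1) ^ 2 = (k + 1) ^ 2 := by exact_mod_cast h3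
      exact h (by simpa using Nat.pow_left_injective two_ne_zero h4)
  have h2 : AnalyticAt ℂ (fun ζ => -S k / (2 * (ζ + ξ))) ξ := by
    refine analyticAt_const.div (by fun_prop) ?_
    rw [← two_mul]
    exact mul_ne_zero two_ne_zero (mul_ne_zero two_ne_zero hξ0)
  refine ⟨fun ζ => -S k / (2 * (ζ + ξ)) + poleSum (Function.update S k 0) ρ ζ, h2.add h1, ?_⟩
  have h3 : ∀ᶠ ζ in 𝓝[≠] ξ, ζ + ξ ≠ 0 := by
    refine nhdsWithin_le_nhds ?_
    refine ContinuousAt.eventually_ne (by fun_prop) ?_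
    rw [← two_mul]
    exact mul_ne_zero two_ne_zero hξ0
  filter_upwards [h3, self_mem_nhdsWithin] with ζ h4 h5
  have h5 : ζ - ξ ≠ 0 := sub_ne_zero.2 h5
  rw [poleSum_eq_add hS hρ k, ← hξ, ← add_assoc]
  congr 1
  rw [show ξ ^ 2 - ζ ^ 2 = -((ζ - ξ) * (ζ + ξ)) by ring]
  field_simp
  ring

/-- The Taylor expansion of `poleSum` at the origin. -/
theorem hasSum_poleSum {S : ℕ → ℂ} (hS : Summable fun n : ℕ => ‖S n‖ / ((n : ℝ) + 1) ^ 2)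
    {ρ : ℂ} (hρ : ρ ≠ 0) {ζ : ℂ} (hζ : ‖ζ‖ ≤ ‖ρ‖ / 2) :
    HasSum (fun j : ℕ => (∑' n : ℕ, S n / ((n + 1 : ℂ)) ^ (2 * j + 2))
      * (1 / ρ ^ (2 * j + 2)) * ζ ^ (2 * j + 1)) (poleSum S ρ ζ) := by
  have hρ0 : 0 < ‖ρ‖ := norm_pos_iff.2 hρ
  set G : ℕ × ℕ → ℂ := fun p =>
    S p.1 / ((p.1 + 1 : ℂ)) ^ (2 * p.2 + 2) * (1 / ρ ^ (2 * p.2 + 2) * ζ ^ (2 * p.2 + 1)) with hG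
  have hlt : ∀ n : ℕ, ‖(ζ / ((n + 1 : ℂ) * ρ)) ^ 2‖ < 1 := by
    intro n
    rw [norm_pow, norm_div, norm_mul, norm_succ]
    refine pow_lt_one₀ (by positivity) ?_ two_ne_zero
    rw [div_lt_one (by positivity)]
    nlinarith [(n.cast_nonneg : (0 : ℝ) ≤ n)]
  have hGs : Summable G := by
    have hg := summable_geometric_of_lt_one (r := (1 / 2 : ℝ)) (by norm_num) (by norm_num)
    refine Summable.of_norm_bounded ((hS.mul_of_nonneg hg (fun _ => by positivity)
      fun _ => by positivity).mul_left (1 / ‖ρ‖)) ?_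
    rintro ⟨n, j⟩
    simp only [hG]
    rw [norm_mul, norm_div, norm_pow, norm_succ, norm_mul, norm_div, norm_one, norm_pow, norm_pow]
    have h1 : 1 / ‖ρ‖ ^ (2 * j + 2) * ‖ζ‖ ^ (2 * j + 1) ≤ 1 / ‖ρ‖ * (1 / 2) ^ j := by
      calc 1 / ‖ρ‖ ^ (2 * j + 2) * ‖ζ‖ ^ (2 * j + 1)
          ≤ 1 / ‖ρ‖ ^ (2 * j + 2) * (‖ρ‖ / 2) ^ (2 * j + 1) := by gcongr
        _ = 1 / ‖ρ‖ * (1 / 2) ^ (2 * j + 1) := by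
            rw [div_pow, one_div_pow, pow_succ ‖ρ‖ (2 * j + 1)]; field_simp
        _ ≤ 1 / ‖ρ‖ * (1 / 2) ^ j := by
            gcongr ?_ * ?_
            exact pow_le_pow_of_le_one (by norm_num) (by norm_num) (by omega)
    have h2 : ((n : ℝ) + 1) ^ 2 ≤ ((n : ℝ) + 1) ^ (2 * j + 2) :=
      pow_le_pow_right₀ (by linarith [(n.cast_nonneg : (0 : ℝ) ≤ n)]) (by omega)
    calc ‖S n‖ / ((n : ℝ) + 1) ^ (2 * j + 2) * (1 / ‖ρ‖ ^ (2 * j + 2) * ‖ζ‖ ^ (2 * j + 1))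
        ≤ ‖S n‖ / ((n : ℝ) + 1) ^ 2 * (1 / ‖ρ‖ * (1 / 2) ^ j) := by gcongr
      _ = _ := by ring
  have hrow : ∀ n, ∑' j, G (n, j) = S n * (ζ / (((n + 1 : ℂ) * ρ) ^ 2 - ζ ^ 2)) := by
    intro n
    have hn : (n + 1 : ℂ) ≠ 0 := Nat.cast_add_one_ne_zero n
    have h1 := (hasSum_geometric_of_norm_lt_one (hlt n)).mul_left
      (S n * (ζ / ((n + 1 : ℂ) * ρ) ^ 2))
    have h2 : ∀ j, G (n, j) = S n * (ζ / ((n + 1 : ℂ) * ρ) ^ 2) *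
        ((ζ / ((n + 1 : ℂ) * ρ)) ^ 2) ^ j := by
      intro j
      simp only [hG]
      rw [← pow_mul, div_pow, mul_pow, mul_pow, pow_add _ (2 * j) 2, pow_add _ (2 * j) 2,
        pow_succ ζ (2 * j)]
      field_simp
    simp only [h2]
    rw [h1.tsum_eq]
    have h3 : 1 - (ζ / ((n + 1 : ℂ) * ρ)) ^ 2 ≠ 0 := fun h0 => by
      have := hlt n
      rw [← sub_eq_zero.1 h0] at this
      simp at this
    have h4 : (1 - (ζ / ((n + 1 : ℂ) * ρ)) ^ 2) * ((n + 1 : ℂ) * ρ) ^ 2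
        = ((n + 1 : ℂ) * ρ) ^ 2 - ζ ^ 2 := by
      have : (n + 1 : ℂ) * ρ ≠ 0 := mul_ne_zero hn hρ
      rw [div_pow]; field_simp
    rw [← h4, ← div_eq_mul_inv, mul_div_assoc, div_div, mul_comm (((n + 1 : ℂ) * ρ) ^ 2)]
  have hswap : Summable fun p : ℕ × ℕ => G p.swap := (Equiv.prodComm ℕ ℕ).summable_iff.2 hGs
  have htot : ∑' p : ℕ × ℕ, G p.swap = poleSum S ρ ζ := by
    have h1 : ∑' p : ℕ × ℕ, G p.swap = ∑' p, G p := (Equiv.prodComm ℕ ℕ).tsum_eq G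
    rw [h1, hGs.tsum_prod]
    exact tsum_congr hrow
  have hcol := hswap.hasSum.prod_fiberwise fun j => (hswap.prod_factor j).hasSum
  rw [htot] at hcol
  refine hcol.congr_fun fun j => ?_
  simp only [hG, Prod.swap_prod_mk]
  rw [tsum_mul_right, mul_assoc]

/-! ### The weak-coupling series -/

theorem summable_norm_stokesS (m n : ℕ) :
    Summable fun k : ℕ => ‖stokesS m n ((k : ℤ) + 1)‖ / ((k : ℝ) + 1) ^ 2 := by
  have hs : Summable fun p : ℕ × ℕ =>
      6 / ((p.1 + 1 : ℕ) : ℝ) * (1 / (((p.1 + 1) * (p.2 + 1) : ℕ) : ℝ) ^ 2) := by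
    refine Summable.of_nonneg_of_le (fun _ => by positivity) (fun p => ?_)
      ((summable_inverse_square.mul_of_nonneg summable_inverse_square (fun _ => by positivity)
        fun _ => by positivity).mul_left 6)
    have h1 : 6 / ((p.1 + 1 : ℕ) : ℝ) ≤ 6 := by
      refine div_le_self (by norm_num) ?_
      simp
    calc 6 / ((p.1 + 1 : ℕ) : ℝ) * (1 / (((p.1 + 1) * (p.2 + 1) : ℕ) : ℝ) ^ 2)
        ≤ 6 * (1 / (((p.1 + 1) * (p.2 + 1) : ℕ) : ℝ) ^ 2) := by gcongr
      _ = _ := by push_cast; field_simp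
  have h1 := (hasSum_divisors (F := fun d l => 6 / (d : ℝ) * (1 / ((d * l : ℕ) : ℝ) ^ 2))
    hs).summable
  refine Summable.of_nonneg_of_le (fun _ => by positivity) (fun k => ?_) h1
  rw [stokesS_eq_sum, show ((k : ℤ) + 1).natAbs = k + 1 by omega, div_eq_mul_one_div]
  refine (mul_le_mul_of_nonneg_right (norm_sum_le _ _) (by positivity)).trans ?_
  rw [Finset.sum_mul]
  refine Finset.sum_le_sum fun d hd => ?_
  rw [Nat.mul_div_cancel' (Nat.dvd_of_mem_divisors hd), norm_div, norm_natCast]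
  push_cast
  gcongr
  exact norm_sineCoeff_le m n d

/-- `S` is the Dirichlet convolution of `t_d / d` with the constant `1`, so its Dirichlet series is
a product. -/
theorem tsum_stokesS_div_pow (m n j : ℕ) :
    ∑' k : ℕ, stokesS m n ((k : ℤ) + 1) / ((k + 1 : ℂ)) ^ (2 * j + 2)
      = (∑' d : ℕ, sineCoeff m n (d + 1) / ((d + 1 : ℂ)) ^ (2 * j + 3))
        * ∑' l : ℕ, 1 / ((l + 1 : ℂ)) ^ (2 * j + 2) := by
  have hle : ∀ i : ℕ, 2 ≤ i → ∀ d : ℕ, 1 / ((d : ℝ) + 1) ^ i ≤ 1 / ((d : ℝ) + 1) ^ 2 := by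
    intro i hi d
    have : ((d : ℝ) + 1) ^ 2 ≤ ((d : ℝ) + 1) ^ i :=
      pow_le_pow_right₀ (by linarith [(d.cast_nonneg : (0 : ℝ) ≤ d)]) hi
    gcongr
  have hs1 : Summable fun d : ℕ => ‖sineCoeff m n (d + 1) / ((d + 1 : ℂ)) ^ (2 * j + 3)‖ := by
    refine Summable.of_nonneg_of_le (fun _ => norm_nonneg _) (fun d => ?_)
      (summable_inverse_square.mul_left 6)
    rw [norm_div, norm_pow, norm_succ, div_eq_mul_one_div]
    exact mul_le_mul (norm_sineCoeff_le m n _) (hle (2 * j + 3) (by omega) d) (by positivity)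
      (by norm_num)
  have hs2 : Summable fun l : ℕ => ‖1 / ((l + 1 : ℂ)) ^ (2 * j + 2)‖ := by
    refine Summable.of_nonneg_of_le (fun _ => norm_nonneg _) (fun d => ?_) summable_inverse_square
    rw [norm_div, norm_pow, norm_succ, norm_one]
    exact hle (2 * j + 2) (by omega) d
  have hF : Summable fun p : ℕ × ℕ => sineCoeff m n (p.1 + 1) / ((p.1 + 1 : ℕ) : ℂ) ^ (2 * j + 3)
      * (1 / ((p.2 + 1 : ℕ) : ℂ) ^ (2 * j + 2)) := by
    have := summable_mul_of_summable_norm hs1 hs2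
    exact_mod_cast this
  have h1 := hasSum_divisors (F := fun d l => sineCoeff m n d / (d : ℂ) ^ (2 * j + 3)
      * (1 / (l : ℂ) ^ (2 * j + 2))) hF
  rw [tsum_mul_tsum_of_summable_norm hs1 hs2]
  have h2 := h1.tsum_eq
  push_cast at h2
  rw [← h2]
  refine tsum_congr fun k => ?_
  rw [stokesS_eq_sum, show ((k : ℤ) + 1).natAbs = k + 1 by omega, Finset.sum_div]
  refine Finset.sum_congr rfl fun d hd => ?_
  have hd0 : (d : ℂ) ≠ 0 := by exact_mod_cast (Nat.pos_of_mem_divisors hd).ne'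
  have hk : ((d : ℂ) * (((k + 1) / d : ℕ) : ℂ)) = (k + 1 : ℂ) := by
    exact_mod_cast Nat.mul_div_cancel' (Nat.dvd_of_mem_divisors hd)
  have hl0 : (((k + 1) / d : ℕ) : ℂ) ≠ 0 := fun h0 => by
    rw [h0, mul_zero] at hk
    exact Nat.cast_add_one_ne_zero k hk.symm
  rw [← hk, mul_pow, pow_succ (d : ℂ) (2 * j + 2)]
  field_simp

theorem hasSum_sin_div_pow {N k j : ℕ} (hkN : k ≤ N) (hN : 0 < N) :
    HasSum (fun d : ℕ => Real.sin (2 * Real.pi * k * (d + 1 : ℕ) / N) / ((d : ℝ) + 1) ^ (2 * j + 3))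
      ((-1) ^ j * (2 * Real.pi) ^ (2 * j + 3) / 2 / (2 * j + 3).factorial *
        (((Polynomial.bernoulli (2 * j + 3)).eval ((k : ℚ) / (N : ℚ)) : ℚ) : ℝ)) := by
  have hN0 : (0 : ℝ) < N := by exact_mod_cast hN
  have hx : (((k : ℚ) / N : ℚ) : ℝ) ∈ Set.Icc (0 : ℝ) 1 := by
    push_cast
    exact ⟨by positivity, (div_le_one hN0).2 (by exact_mod_cast hkN)⟩
  have h := hasSum_one_div_nat_pow_mul_sin (k := j + 1) (by omega) hx
  rw [← hasSum_nat_add_iff' 1] at h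
  rw [Polynomial.eval_map, show (((k : ℚ) / N : ℚ) : ℝ) = algebraMap ℚ ℝ ((k : ℚ) / N) from rfl,
    Polynomial.eval₂_at_apply] at h
  simp only [Finset.sum_range_one, Nat.cast_zero, mul_zero, zero_mul, Real.sin_zero, sub_zero,
    show 2 * (j + 1) + 1 = 2 * j + 3 by ring] at h
  have e : (-1 : ℝ) ^ (j + 1 + 1) = (-1) ^ j := by rw [pow_add, pow_add]; norm_num
  rw [e] at h
  refine h.congr_fun fun d => ?_
  rw [one_div_mul_eq_div]
  have e2 : 2 * Real.pi * ((d + 1 : ℕ) : ℝ) * algebraMap ℚ ℝ ((k : ℚ) / N)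
      = 2 * Real.pi * k * (d + 1 : ℕ) / N := by
    rw [map_div₀, map_natCast, map_natCast]; ring
  rw [e2]
  push_cast
  rfl

theorem hasSum_inverse_even_pow (j : ℕ) :
    HasSum (fun l : ℕ => 1 / ((l : ℝ) + 1) ^ (2 * j + 2))
      ((-1) ^ j * 2 ^ (2 * j + 1) * Real.pi ^ (2 * j + 2) * (bernoulli (2 * j + 2) : ℝ)
        / (2 * j + 2).factorial) := by
  have h := hasSum_zeta_nat (k := j + 1) (by omega)
  rw [← hasSum_nat_add_iff' 1] at h
  simp only [show 2 * (j + 1) = 2 * j + 2 by ring] at h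
  have e : (-1 : ℝ) ^ (j + 1 + 1) = (-1) ^ j := by rw [pow_add, pow_add]; norm_num
  rw [e, show 2 * j + 2 - 1 = 2 * j + 1 by omega] at h
  simpa using h

theorem coeff_phi_even (N k j : ℕ) :
    PowerSeries.coeff (2 * j + 2) (phi N k)
      = (2 * Real.pi * I) ^ (2 * j + 2) * ((bernoulli (2 * j + 2) : ℚ) : ℂ)
        * (((Polynomial.bernoulli (2 * j + 3)).eval ((k : ℚ) / (N : ℚ)) : ℚ) : ℂ)
        / ((2 * j + 2 : ℂ) * ((2 * j + 3).factorial : ℂ)) := by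
  simp only [phi, PowerSeries.coeff_mk]
  rw [if_pos ⟨by omega, ⟨j + 1, by ring⟩⟩]
  push_cast
  rfl

/-- Reflection `B_{2j+3}(1 - x) = -B_{2j+3}(x)`. It turns `-φ_{N-1} - φ_{N-m} + φ_n` into `φ_1 + φ_m
+ φ_n`, the combination seen in the sines. -/
theorem coeff_phi_sub {N k j : ℕ} (hkN : k ≤ N) (hN : 0 < N) :
    PowerSeries.coeff (2 * j + 2) (phi N (N - k)) = -PowerSeries.coeff (2 * j + 2) (phi N k) := by
  have hN0 : (N : ℚ) ≠ 0 := by exact_mod_cast hN.ne'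
  have h : ((N - k : ℕ) : ℚ) / N = 1 - (k : ℚ) / N := by
    rw [Nat.cast_sub hkN, sub_div, div_self hN0]
  have ho : (-1 : ℚ) ^ (2 * j + 3) = -1 := Odd.neg_one_pow ⟨j + 1, by ring⟩
  rw [coeff_phi_even, coeff_phi_even, h, Polynomial.bernoulli_eval_one_sub, ho]
  push_cast
  ring

theorem tsum_sineCoeff_div_pow (m n j : ℕ) :
    ∑' d : ℕ, sineCoeff m n (d + 1) / ((d + 1 : ℂ)) ^ (2 * j + 3)
      = 2 * I * ((-1) ^ j * (2 * Real.pi) ^ (2 * j + 3) / 2 / (2 * j + 3).factorial *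
        ((((Polynomial.bernoulli (2 * j + 3)).eval (((1 : ℕ) : ℚ) / ((1 + m + n : ℕ) : ℚ)) : ℚ) : ℂ)
        + (((Polynomial.bernoulli (2 * j + 3)).eval ((m : ℚ) / ((1 + m + n : ℕ) : ℚ)) : ℚ) : ℂ)
        + (((Polynomial.bernoulli (2 * j + 3)).eval ((n : ℚ) / ((1 + m + n : ℕ) : ℚ)) : ℚ) : ℂ))) := by
  have hN : 0 < 1 + m + n := by omega
  have h := ((hasSum_sin_div_pow (k := 1) (N := 1 + m + n) (j := j) (by omega) hN).add
    (hasSum_sin_div_pow (k := m) (j := j) (by omega) hN)).add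
    (hasSum_sin_div_pow (k := n) (j := j) (by omega) hN)
  have h1 := (hasSum_ofReal.2 h).mul_left (2 * I)
  refine (tsum_congr fun d => ?_).trans (h1.tsum_eq.trans ?_)
  · rw [sineCoeff]
    push_cast
    ring
  · rw [← mul_add, ← mul_add]
    push_cast
    rfl

theorem coeff_phiMN_even (m n j : ℕ) :
    PowerSeries.coeff (2 * j + 2) (phiMN m n) / ((2 * j + 1).factorial : ℂ)
      = 1 / (Real.pi * I) * ((∑' k : ℕ, stokesS m n ((k : ℤ) + 1) / ((k + 1 : ℂ)) ^ (2 * j + 2))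
        * (1 / xi m n 1 ^ (2 * j + 2))) := by
  have hN : 0 < 1 + m + n := by omega
  have hN0 : ((1 + m + n : ℕ) : ℂ) ≠ 0 := by exact_mod_cast hN.ne'
  have hπ : (Real.pi : ℂ) ≠ 0 := by exact_mod_cast Real.pi_ne_zero
  have hZ := (hasSum_ofReal.2 (hasSum_inverse_even_pow j)).tsum_eq
  push_cast at hZ
  rw [tsum_stokesS_div_pow, tsum_sineCoeff_div_pow, hZ, phiMN, PowerSeries.coeff_rescale, map_add,
    map_sub, map_neg, coeff_phi_sub (by omega) hN, coeff_phi_sub (by omega) hN, neg_neg,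
    sub_neg_eq_add, coeff_phi_even, coeff_phi_even, coeff_phi_even, xi,
    Nat.factorial_succ (2 * j + 1)]
  generalize (((Polynomial.bernoulli (2 * j + 3)).eval
    (((1 : ℕ) : ℚ) / ((1 + m + n : ℕ) : ℚ)) : ℚ) : ℂ) = A₁
  generalize (((Polynomial.bernoulli (2 * j + 3)).eval
    ((m : ℚ) / ((1 + m + n : ℕ) : ℚ)) : ℚ) : ℂ) = A₂
  generalize (((Polynomial.bernoulli (2 * j + 3)).eval
    ((n : ℚ) / ((1 + m + n : ℕ) : ℚ)) : ℚ) : ℂ) = A₃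
  have hF1 : ((2 * j + 1).factorial : ℂ) ≠ 0 := by exact_mod_cast (2 * j + 1).factorial_ne_zero
  have hF3 : ((2 * j + 3).factorial : ℂ) ≠ 0 := by exact_mod_cast (2 * j + 3).factorial_ne_zero
  have hj : (2 * j + 2 : ℂ) ≠ 0 := by exact_mod_cast (by omega : 2 * j + 2 ≠ 0)
  -- The sine sum and the zeta value each carry `(-1)^j`; the coefficient of `φ` and the power of
  -- `ξ_1` each carry `i^{2j+2}`. Once denominators are cleared only the squares of these signs
  -- remain.
  have hv : ((-1 : ℂ) ^ j) ^ 2 = 1 := by rw [← pow_mul, mul_comm, pow_mul]; simp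
  have hu : (I ^ (2 * j + 2)) ^ 2 = 1 := by
    rw [← pow_mul, show (2 * j + 2) * 2 = 4 * (j + 1) by ring, pow_mul, I_pow_four, one_pow]
  have hu0 : I ^ (2 * j + 2) ≠ 0 := pow_ne_zero _ I_ne_zero
  have h4 : (4 : ℂ) ^ (2 * j + 2) = (2 * 2 ^ (2 * j + 1)) ^ 2 := by
    rw [← pow_succ', ← pow_mul, mul_comm _ 2, pow_mul]; norm_num
  generalize ((1 + m + n : ℕ) : ℂ) = N at *
  push_cast
  generalize ((2 * j + 1).factorial : ℂ) = F₁ at *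
  generalize ((2 * j + 3).factorial : ℂ) = F₃ at *
  generalize ((bernoulli (2 * j + 2) : ℚ) : ℂ) = B at *
  have hp0 : (Real.pi : ℂ) ^ (2 * j + 2) ≠ 0 := pow_ne_zero _ hπ
  have ha0 : (2 : ℂ) ^ (2 * j + 1) ≠ 0 := pow_ne_zero _ two_ne_zero
  have h2 : (2 : ℂ) ^ (2 * j + 2) = 2 * 2 ^ (2 * j + 1) := pow_succ' _ _
  have h3 : (2 : ℂ) ^ (2 * j + 3) = 2 * (2 * 2 ^ (2 * j + 1)) := by rw [pow_succ', h2]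
  have h5 : (Real.pi : ℂ) ^ (2 * j + 3) = Real.pi * Real.pi ^ (2 * j + 2) := pow_succ' _ _
  have h6 : ((Real.pi : ℂ) ^ 2) ^ (2 * j + 2) = (Real.pi ^ (2 * j + 2)) ^ 2 := by
    rw [← pow_mul, mul_comm, pow_mul]
  rw [show (2 * j + 1 + 1 : ℂ) = 2 * j + 2 by ring]
  simp only [mul_pow, div_pow, mul_one, h2, h3, h4, h5, h6]
  generalize (Real.pi : ℂ) ^ (2 * j + 2) = p at *
  generalize (2 : ℂ) ^ (2 * j + 1) = a at *
  generalize I ^ (2 * j + 2) = u at *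
  generalize (-1 : ℂ) ^ j = v at *
  generalize N ^ (2 * j + 2) = M at *
  have hI := I_ne_zero
  field_simp
  rw [hu, hv]
  ring

theorem coeff_phiMN_odd {m n : ℕ} (j : ℕ) : PowerSeries.coeff (2 * j + 1) (phiMN m n) = 0 := by
  have h : ¬ Even (2 * j + 1) := by simp
  simp [phiMN, phi, PowerSeries.coeff_rescale, h]

theorem xi_eq (m n : ℕ) (l : ℤ) : xi m n l = l * xi m n 1 := by
  simp only [xi]
  push_cast
  ring

theorem xi_one_ne_zero (m n : ℕ) : xi m n 1 ≠ 0 := by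
  have hN : ((1 + m + n : ℕ) : ℂ) ≠ 0 := by exact_mod_cast (by omega : 1 + m + n ≠ 0)
  have hπ : (Real.pi : ℂ) ≠ 0 := by exact_mod_cast Real.pi_ne_zero
  simp only [xi]
  have := I_ne_zero
  simp only [Int.cast_one, mul_one]
  exact div_ne_zero (by simp [hπ]) hN

theorem hasStokesConstants_phiMN (m n : ℕ) :
    HasStokesConstants (HahnSeries.ofPowerSeries ℤ ℂ (phiMN m n)) (xi m n) (stokesS m n) := by
  set ρ : ℂ := xi m n 1 with hρ
  have hρ0 : ρ ≠ 0 := xi_one_ne_zero m n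
  set S : ℕ → ℂ := fun k => stokesS m n ((k : ℤ) + 1) with hSdef
  have hS := summable_norm_stokesS m n
  refine ⟨fun ζ => 1 / (Real.pi * I) * poleSum S ρ ζ, ?_, fun ζ hζ => ?_, fun l hl => ?_⟩
  · have hball : Metric.closedBall (0 : ℂ) (‖ρ‖ / 2) ∈ 𝓝 (0 : ℂ) :=
      Metric.closedBall_mem_nhds _ (by have := norm_pos_iff.2 hρ0; positivity)
    filter_upwards [hball] with ζ hζ
    have h1 := (hasSum_poleSum hS hρ0 (by simpa using hζ)).mul_left (1 / (Real.pi * I))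
    -- The candidate is odd in `ζ`, matching the vanishing of the odd coefficients of the
    -- weak-coupling series under the Borel shift by one.
    have hinj : Function.Injective fun j : ℕ => 2 * j + 1 := fun a b h => by simpa using h
    refine (hinj.hasSum_iff fun r hr => ?_).1 (h1.congr_fun fun j => ?_)
    · have he : Even r := by
        by_contra ho
        obtain ⟨j, rfl⟩ := Nat.not_even_iff_odd.1 ho
        exact hr ⟨j, rfl⟩
      obtain ⟨j, rfl⟩ := he
      have h2 := HahnSeries.ofPowerSeries_apply_coeff (Γ := ℤ) (phiMN m n) (2 * j + 1)
      rw [coeff_phiMN_odd] at h2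
      push_cast at h2 ⊢
      rw [← two_mul, h2]
      simp
    · have h2 := HahnSeries.ofPowerSeries_apply_coeff (Γ := ℤ) (phiMN m n) (2 * j + 2)
      have h3 : ((2 * j + 1 : ℕ) : ℤ) + 1 = ((2 * j + 2 : ℕ) : ℤ) := by push_cast; ring
      simp only [Function.comp]
      rw [h3, h2, coeff_phiMN_even]
      ring
  · refine analyticAt_const.mul (poleSum_analyticAt hS hρ0 fun k => Or.inr fun h => ?_)
    rcases sq_eq_sq_iff_eq_or_eq_neg.1 h with h | h
    · refine hζ (k + 1) (by omega) ?_
      rw [xi_eq, ← h]; push_cast; rfl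
    · refine hζ (-(k + 1)) (by omega) ?_
      rw [xi_eq, ← neg_eq_iff_eq_neg.2 h]; push_cast; ring
  · obtain ⟨k, hk⟩ : ∃ k : ℕ, l.natAbs = k + 1 := ⟨l.natAbs - 1, by omega⟩
    have hSl : S k = stokesS m n l := by
      simp only [hSdef]
      rw [stokesS_eq_sum, stokesS_eq_sum, hk, show ((k : ℤ) + 1).natAbs = k + 1 by omega]
    have hξ : xi m n l ^ 2 = ((k + 1 : ℂ) * ρ) ^ 2 := by
      rw [xi_eq, mul_pow, mul_pow]
      congr 1
      have h1 : l ^ 2 = ((k : ℤ) + 1) ^ 2 := by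
        rw [← Int.natAbs_sq, hk]; push_cast; ring
      exact_mod_cast h1
    obtain ⟨h, hh, he⟩ := exists_pole_of_poleSum hS hρ0 k hξ
    refine ⟨fun ζ => 1 / (Real.pi * I) * h ζ, analyticAt_const.mul hh, ?_⟩
    filter_upwards [he] with ζ hζ
    have hζ : poleSum S ρ ζ = -S k / (2 * (ζ - xi m n l)) + h ζ := hζ
    rw [hζ, hSl, mul_add]
    congr 1
    rw [one_div_mul_eq_div, div_div]
    congr 1
    ring

end LocalP

theorem theorem1p7 (m n : ℕ) (hm : 0 < m) (hn : 0 < n) :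
    -- the numbers generated by `f0` are the Stokes constants of the weak-coupling series
    LocalP.HasStokesConstants (HahnSeries.ofPowerSeries ℤ ℂ (LocalP.phiMN m n))
      (LocalP.xi m n) (LocalP.stokesS m n) ∧
    -- upper half-plane
    ((∃ φ : LaurentSeries ℂ, LocalP.IsAsymptoticExpansion (LocalP.f0 m n) (Real.pi / 2) φ) ∧
      ∀ φ : LaurentSeries ℂ, LocalP.IsAsymptoticExpansion (LocalP.f0 m n) (Real.pi / 2) φ →
        LocalP.IsGevreyOne φ ∧
        ∀ y : ℂ, 0 < y.im → LocalP.HasMedianSum φ (Real.pi / 2) y (LocalP.f0 m n y)) ∧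
    -- lower half-plane
    ((∃ φ : LaurentSeries ℂ, LocalP.IsAsymptoticExpansion (LocalP.f0 m n) (-(Real.pi / 2)) φ) ∧
      ∀ φ : LaurentSeries ℂ, LocalP.IsAsymptoticExpansion (LocalP.f0 m n) (-(Real.pi / 2)) φ →
        LocalP.IsGevreyOne φ ∧
        ∀ y : ℂ, y.im < 0 → LocalP.HasMedianSum φ (-(Real.pi / 2)) y (LocalP.f0 m n y)) := by
  have upper := LocalP.exists_resurgence hm hn (σ := 1) (Or.inl rfl)
  have lower := LocalP.exists_resurgence hm hn (σ := -1) (Or.inr rfl)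
  simp only [one_mul, neg_one_mul, neg_pos] at upper lower
  obtain ⟨φ, h1, h2, h3⟩ := upper
  obtain ⟨ψ, k1, k2, k3⟩ := lower
  refine ⟨LocalP.hasStokesConstants_phiMN m n, ⟨⟨φ, h1⟩, fun χ hχ => ?_⟩,
    ⟨⟨ψ, k1⟩, fun χ hχ => ?_⟩⟩
  -- An arbitrary expansion coincides with the constructed one.
  · rw [hχ.unique h1]
    exact ⟨h2, h3⟩
  · rw [hχ.unique k1]
    exact ⟨k2, k3⟩
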